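/- **Setting.** A Fréchet space is a real, complete, metrizable, Hausdorff locally convex topological vector space. A map $f:U\subseteq E\to F$ from an open subset of a Fréchet space to a Fréchet space is (Keller) $C^1$ if it is continuous, all directional derivatives $Df(x)h=\lim_{t\to0}t^{-1}(f(x+th)-f(x))$ exist, $Df(x):E\to F$ is linear and continuous for every $x\in U$, and $x\mapsto Df(x)$ is continuous into the space of continuous linear maps with the compact-open topology. A $C^1$-Fréchet manifold is a Hausdorff, second countable space with an atlas of charts in a Fréchet space whose coordinate changes are Keller $C^1$; $C^1$ maps between such manifolds are defined in charts. A graded Finsler structure on a $C^1$-Fréchet manifold $M$ modelled on $F$ is a sequence of functions $\|\cdot\|_n:TM\to[0,\infty)$, $n\ge 1$, with $\|\cdot\|_n\le\|\cdot\|_{n+1}$, such that around every point there is a chart $e:U\to e(U)\subseteq F$ (compatible with the atlas) in whose induced trivialization $TM|_U\cong e(U)\times F$ the functions $\|\cdot\|_n$ are continuous, the $(\|\cdot\|_n^{u})_n$ are, for each $u\in e(U)$, seminorms defining the topology of $F$, and for all $k>1$ and $u_0\in e(U)$ there is a neighbourhood $W$ of $u_0$ with $\frac1k\|w\|_n^{u_0}\le\|w\|_n^{u}\le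 k\|w\|_n^{u_0}$ for all $u\in W$, $n\ge 1$, $w\in F$. For connected $M$ put $$\rho_n(x,y)=\inf_\gamma\int\|\gamma'(t)\|_n\,dt,\qquad \rho(x,y)=\sum_{n\ge1}2^{-n}\frac{\rho_n(x,y)}{1+\rho_n(x,y)},$$ the infimum being over piecewise $C^1$ curves $\gamma$ from $x$ to $y$; $\rho$ is the Finsler metric. A $C^1$ functional $f:M\to\mathbb R$ satisfies the (PS)-condition at level $c\in\mathbb R$ if every sequence $(m_i)$ in $M$ with $f(m_i)\to c$ and $\Phi_f(m_i)\to0$ has a convergent subsequence, where $\Phi_f(x)=\inf\{f'(x)h: h\in T_xM,\ \|h\|_n\le1\ \text{for all } n\}$. **Theorem.** Let $M,N$ be connected $C^1$-Fréchet manifolds, each endowed with a graded Finsler structure whose Finsler metric is complete. Suppose that $N$ also carries a group structure, written additively with neutral element $0$ (and not assumed commutative), all of whose translations $y\mapsto y-q$, $q\in N$, are of class $C^1$; for instance, $N$ may be a Fréchet space. Let $\varphi:M\to N$ be a local diffeomorphism of class $C^1$ (every point of $M$ has an open neighbourhood that $\varphi$ maps bijectively onto an open set, with $\varphi$ and the inverse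 of class $C^1$). Let $I:N\to[0,\infty)$ be a $C^1$ functional such that $I(y)=0$ if and only if $y=0$, and $I'(y)=0$ if and only if $y=0$. If for every $q\in N$ the functional $x\mapsto I(\varphi(x)-q)$ on $M$ satisfies the (PS)-condition at every level $c\in\mathbb R$, then $\varphi$ is a global $C^1$ diffeomorphism: it is a bijection, and $\varphi$ and $\varphi^{-1}$ are of class $C^1$. -/

import Mathlib

open Set Filter Topology

open scoped Manifold CompactConvergenceCLM

noncomputable section

/-- A (real) Fréchet space: a Hausdorff, complete, first countable (equivalently, metrizable),
locally convex topological vector space. -/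
class FrechetSpace (F : Type*) [AddCommGroup F] [Module ℝ F] [UniformSpace F] : Prop extends
  IsUniformAddGroup F, ContinuousSMul ℝ F, LocallyConvexSpace ℝ F, T2Space F, CompleteSpace F,
  FirstCountableTopology F

/-! ### Keller differentiability between topological vector spaces -/

section Keller

variable {E F : Type*}
  [AddCommGroup E] [Module ℝ E] [TopologicalSpace E]
  [AddCommGroup F] [Module ℝ F] [TopologicalSpace F] [IsTopologicalAddGroup F]

/-- `v` is the directional derivative of `f` at `x` in the direction `h`:
`v = lim_{t → 0} (f (x + t h) - f x) / t`. -/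
def HasDirDeriv (f : E → F) (x h : E) (v : F) : Prop :=
  Tendsto (fun t : ℝ => t⁻¹ • (f (x + t • h) - f x)) (𝓝[≠] (0 : ℝ)) (𝓝 v)

/-- The directional derivative `D f(x) h` (only used where it exists). -/
def dirDeriv (f : E → F) (x h : E) : F :=
  haveI : Nonempty F := ⟨0⟩
  limUnder (𝓝[≠] (0 : ℝ)) (fun t : ℝ => t⁻¹ • (f (x + t • h) - f x))

/-- `f` is of class `C¹` in the sense of Keller on the (open) set `U`: it is continuous, all
directional derivatives exist, `D f(x)` is a continuous linear map for `x ∈ U`, and `x ↦ D f(x)`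
is continuous from `U` to the space of continuous linear maps with the compact-open topology
(uniform convergence on compact sets, written `E →L_c[ℝ] F`). -/
def KellerC1On (f : E → F) (U : Set E) : Prop :=
  ContinuousOn f U ∧
    ∃ f' : E → (E →L_c[ℝ] F),
      (∀ x ∈ U, ∀ h : E, HasDirDeriv f x h (f' x h)) ∧ ContinuousOn f' U

end Keller

/-! ### `C¹`-Fréchet manifolds -/

section Manifold

variable (F E : Type*)
  [AddCommGroup F] [Module ℝ F] [TopologicalSpace F] [IsTopologicalAddGroup F]
  [AddCommGroup E] [Module ℝ E] [TopologicalSpace E] [IsTopologicalAddGroup E]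
  {M N : Type*} [TopologicalSpace M] [ChartedSpace F M] [TopologicalSpace N] [ChartedSpace E N]

variable {F} in
/-- `e` is a chart of the maximal `C¹`-atlas: its transitions to and from all charts of the given
atlas are Keller `C¹`. -/
def IsC1Chart (e : OpenPartialHomeomorph M F) : Prop :=
  ∀ e' ∈ atlas F M,
    KellerC1On (e' ∘ e.symm) (e.symm ≫ₕ e').source ∧
    KellerC1On (e ∘ e'.symm) (e'.symm ≫ₕ e).source

/-- The coordinate changes of the atlas of `M` are Keller `C¹`. A `C¹`-Fréchet manifold modelled on
the Fréchet space `F` is a Hausdorff second countable space `M` with such an atlas. -/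
class FrechetC1Manifold (F M : Type*)
    [AddCommGroup F] [Module ℝ F] [TopologicalSpace F] [IsTopologicalAddGroup F]
    [TopologicalSpace M] [ChartedSpace F M] : Prop where
  compatible : ∀ e ∈ atlas F M, ∀ e' ∈ atlas F M,
    KellerC1On (e' ∘ e.symm) (e.symm ≫ₕ e').source

/-- `f : M → N` is of class `C¹` on the open set `s`: it is continuous there and all its
representatives in charts are Keller `C¹`. -/
def IsC1On (f : M → N) (s : Set M) : Prop :=
  ContinuousOn f s ∧
    ∀ e ∈ atlas F M, ∀ e' ∈ atlas E N,
      KellerC1On (e' ∘ f ∘ e.symm) (e.target ∩ e.symm ⁻¹' (s ∩ f ⁻¹' e'.source))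

/-- A local diffeomorphism of class `C¹`: every point has an open neighbourhood which `f` maps
homeomorphically onto an open set, with `f` and the inverse both of class `C¹`. -/
def IsC1LocalDiffeo (f : M → N) : Prop :=
  ∀ x : M, ∃ e : OpenPartialHomeomorph M N, x ∈ e.source ∧ EqOn f e e.source ∧
    IsC1On F E e e.source ∧ IsC1On E F e.symm e.target

/-- A (global) diffeomorphism of class `C¹`: a `C¹` bijection with `C¹` inverse. -/
def IsC1Diffeo (f : M → N) : Prop :=
  IsC1On F E f univ ∧
    ∃ g : N → M, Function.LeftInverse g f ∧ Function.RightInverse g f ∧ IsC1On E F g univ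

variable {F}

/-! The tangent space `T_x M` is identified with the model space `F` through the preferred chart
`chartAt F x` at `x`, as is done in Mathlib. -/

/-- The tangent vector at `e.symm u` whose coordinate in the chart `e` is `w`. -/
def tangentOfCoord (e : OpenPartialHomeomorph M F) (u w : F) : F :=
  dirDeriv (chartAt F (e.symm u) ∘ e.symm) u w

/-- The coordinate in the chart `e` of the tangent vector `h ∈ T_x M`. -/
def coordOfTangent (e : OpenPartialHomeomorph M F) (x : M) (h : F) : F :=
  dirDeriv (e ∘ (chartAt F x).symm) (chartAt F x x) h

/-- The derivative `φ'(x, h)` of a functional `φ` at `x` in the direction `h ∈ T_x M`. -/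
def functionalDeriv (φ : M → ℝ) (x : M) (h : F) : ℝ :=
  dirDeriv (φ ∘ (chartAt F x).symm) (chartAt F x x) h

variable (F) in
/-- `x` is a critical point of `φ`: `φ'(x) = 0`. -/
def IsCriticalPt (φ : M → ℝ) (x : M) : Prop :=
  ∀ h : F, functionalDeriv φ x h = 0

end Manifold

/-! ### Finsler structures, Finsler metrics -/

/-- The functions `p n : U × F → ℝ` form a Finsler structure for the trivial bundle `U × F`, where
`U` is a subset of the space `T`. -/
structure IsFinslerOn {T F : Type*} [TopologicalSpace T] [AddCommGroup F] [Module ℝ F]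
    [TopologicalSpace F] (U : Set T) (p : ℕ → T → F → ℝ) : Prop where
  continuousOn : ∀ n, ContinuousOn (fun z : T × F => p n z.1 z.2) (U ×ˢ univ)
  seminorms : ∀ b ∈ U, ∃ s : SeminormFamily ℝ F ℕ, (∀ n w, s n w = p n b w) ∧ WithSeminorms s
  locally_equiv : ∀ b ∈ U, ∀ k : ℝ, 1 < k → ∀ᶠ b' in 𝓝[U] b, ∀ (n : ℕ) (w : F),
    k⁻¹ * p n b w ≤ p n b' w ∧ p n b' w ≤ k * p n b w

/-- A graded Finsler structure on (the tangent bundle of) the manifold `M`: an increasing sequence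
of functions `‖·‖ₙ : TM → ℝ`, each a seminorm on every `T_x M`, which is a Finsler structure for
`e.target × F` in the bundle chart of `TM` induced by some chart `e` around each point. -/
structure GradedFinsler (F M : Type*)
    [AddCommGroup F] [Module ℝ F] [TopologicalSpace F] [IsTopologicalAddGroup F]
    [TopologicalSpace M] [ChartedSpace F M] where
  /-- The seminorm `‖·‖ₙ` on `T_x M`. -/
  snorm : ℕ → M → Seminorm ℝ F
  graded : ∀ x : M, Monotone fun n => snorm n x
  locally_finsler : ∀ x : M, ∃ e : OpenPartialHomeomorph M F, IsC1Chart e ∧ x ∈ e.source ∧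
    IsFinslerOn e.target fun n u w => snorm n (e.symm u) (tangentOfCoord e u w)

section Finsler

variable {F M : Type*}
  [AddCommGroup F] [Module ℝ F] [TopologicalSpace F] [IsTopologicalAddGroup F]
  [TopologicalSpace M] [ChartedSpace F M]

/-- `γ : [a, b] → M` is a `C¹`-curve with velocity `v t ∈ T_{γ t} M`: it is continuous, and in each
chart `e` of the atlas, `e ∘ γ` is differentiable (one-sidedly at `a` and `b`) wherever it is
defined, with continuous derivative given by the coordinate of `v`. -/
def IsC1Curve (a b : ℝ) (γ : ℝ → M) (v : ℝ → F) : Prop :=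
  ContinuousOn γ (Icc a b) ∧ ∀ e ∈ atlas F M,
    (∀ t ∈ Icc a b ∩ γ ⁻¹' e.source,
      Tendsto (fun s : ℝ => (s - t)⁻¹ • (e (γ s) - e (γ t))) (𝓝[Icc a b \ {t}] t)
        (𝓝 (coordOfTangent e (γ t) (v t)))) ∧
    ContinuousOn (fun t => coordOfTangent e (γ t) (v t)) (Icc a b ∩ γ ⁻¹' e.source)

namespace GradedFinsler

variable (S : GradedFinsler F M)

/-- `S.HasPath n x y ℓ`: some piecewise `C¹`-curve from `x` to `y`, i.e. a finite concatenation
of `C¹`-curves, has length `ℓ` with respect to `‖·‖ₙ`. -/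
inductive HasPath (n : ℕ) (x : M) : M → ℝ → Prop
  | nil : HasPath n x x 0
  | snoc {y : M} {ℓ : ℝ} (hp : HasPath n x y ℓ) (a b : ℝ) (hab : a ≤ b) (γ : ℝ → M) (v : ℝ → F)
      (hγ : IsC1Curve a b γ v) (ha : γ a = y) :
      HasPath n x (γ b) (ℓ + ∫ t in a..b, S.snorm n (γ t) (v t))

/-- The pseudo-distance `ρₙ`: infimum of the `n`-th lengths of piecewise `C¹`-curves. -/
def distN (n : ℕ) (x y : M) : ℝ := sInf {ℓ : ℝ | S.HasPath n x y ℓ}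

/-- The Finsler metric `ρ = ∑_{n ≥ 1} 2⁻ⁿ ρₙ / (1 + ρₙ)` (seminorms are indexed from `0` here). -/
def finslerDist (x y : M) : ℝ :=
  ∑' n : ℕ, (1 / 2 : ℝ) ^ (n + 1) * (S.distN n x y / (1 + S.distN n x y))

/-- Completeness of the Finsler metric: Cauchy sequences converge. -/
def IsCompleteMetric : Prop :=
  ∀ u : ℕ → M,
    (∀ ε : ℝ, 0 < ε → ∃ K : ℕ, ∀ i ≥ K, ∀ j ≥ K, S.finslerDist (u i) (u j) < ε) →
    ∃ x : M, Tendsto (fun i => S.finslerDist (u i) x) atTop (𝓝 0)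

/-! ### The Palais–Smale condition -/

/-- The set `B_∞(0_x)` of the `h ∈ T_x M` with `‖h‖ₙ ≤ 1` for all `n`. -/
def unitBall (x : M) : Set F := {h : F | ∀ n, S.snorm n x h ≤ 1}

/-- `Φ_φ(x) = inf {φ'(x, h) : h ∈ B_∞(0_x)}`. -/
def slopeFn (φ : M → ℝ) (x : M) : ℝ := sInf (functionalDeriv φ x '' S.unitBall x)

/-- The Palais–Smale condition at the level `c` (on all of `M`). -/
def PalaisSmaleAt (φ : M → ℝ) (c : ℝ) : Prop :=
  ∀ m : ℕ → M, Tendsto (fun i => φ (m i)) atTop (𝓝 c) →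
    Tendsto (fun i => S.slopeFn φ (m i)) atTop (𝓝 0) →
    ∃ (x : M) (k : ℕ → ℕ), StrictMono k ∧ Tendsto (m ∘ k) atTop (𝓝 x)

end GradedFinsler

end Finsler

end

noncomputable section

/-! ### Ekeland's principle, weak slope and mountain passes in complete metric spaces. -/

section Variational

/-! Fix `q` and put `J x = I (φ x - q)`, so that `J ≥ 0` and `J` vanishes exactly on the fibre over
`q`. Since `φ` is a local diffeomorphism and `I'` vanishes only at `0`, every critical point of `J`
lies in this fibre (`isCriticalPt_sub`). Surjectivity follows because the Palais–Smale condition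
turns a minimizing sequence into a critical point (`exists_tendsto_of_minimizing`). For injectivity,
two points of one fibre are two zeros of `J`, the first isolated because `φ` is locally injective. A
mountain pass between them gives a critical point at a positive level
(`exists_isCriticalPt_of_two_zeros`), whereas `J` is zero at critical points.

Fréchet spaces have no general flow theory, so descent is expressed metrically: `Deformable` says
that the points near `x` can be moved so that `f` drops at rate `ε` per unit of distance. Ekeland's
principle, on the manifold or on a space of paths, yields points that are almost not deformable.

The delicate point is the passage to the limit. `Φ` tests the derivative only on vectors with all
seminorms at most `1`, a set that may be `{0}`, so `Φ → 0` does not make the limit critical. The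
Finsler metric is therefore replaced by a uniformly equivalent one, built from `min (2⁻ⁿ) (wₙ ρₙ)`,
with weights so small that the vectors with `∑ wₙ ‖h‖ₙ < ∞` span a dense subspace
(`exists_spanning_weights`). Such vectors have finite speed in the new metric, so the absence of
deformations bounds the derivative along them. With `wₙ ≤ 2⁻ⁿ` it also forces `Φ → 0`
(`slopeFn_mem_Icc`). The Palais–Smale condition then gives a limit point, at which the derivative
vanishes on a dense subspace and hence everywhere (`exists_tendsto_isCriticalPt`). -/

theorem exists_ekeland_point {X : Type*} [MetricSpace X] [CompleteSpace X] {f : X → ℝ}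
    (hf : LowerSemicontinuous f) (hb : BddBelow (range f)) {ε : ℝ} (hε : 0 < ε) (x₀ : X) :
    ∃ x, f x + ε * dist x x₀ ≤ f x₀ ∧ ∀ y, f x ≤ f y + ε * dist y x := by
  -- Order the points by `y ≼ x` when `f y + ε * dist y x ≤ f x`, and descend by choosing an almost
  -- minimal value of `f` below the current point. Distances are controlled by the drop of `f`, so
  -- the chosen points form a Cauchy sequence.
  have hstep : ∀ (n : ℕ) (x : X), ∃ z, f z + ε * dist z x ≤ f x ∧
      ∀ y, f y + ε * dist y x ≤ f x → f z ≤ f y + (1 / 2 : ℝ) ^ n := by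
    intro n x
    set S : Set X := {y | f y + ε * dist y x ≤ f x}
    have hne : (f '' S).Nonempty := ⟨f x, x, by simp [S], rfl⟩
    have hbd : BddBelow (f '' S) := hb.mono (image_subset_range _ _)
    obtain ⟨_, ⟨z, hz, rfl⟩, hlt⟩ := exists_lt_of_csInf_lt hne
      (show sInf (f '' S) < sInf (f '' S) + (1 / 2 : ℝ) ^ n by
        have : (0 : ℝ) < (1 / 2) ^ n := by positivity
        linarith)
    refine ⟨z, hz, fun y hy => ?_⟩
    have := csInf_le hbd (mem_image_of_mem f (show y ∈ S from hy))
    linarith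
  choose g hg₁ hg₂ using hstep
  let u : ℕ → X := fun n => Nat.rec x₀ (fun n x => g n x) n
  have hu : ∀ n, u (n + 1) = g n (u n) := fun n => rfl
  have hmono : ∀ n k, f (u (n + k)) + ε * dist (u (n + k)) (u n) ≤ f (u n) := by
    intro n k
    induction k with
    | zero => simp
    | succ k ih =>
      have h := hg₁ (n + k) (u (n + k))
      rw [← hu] at h
      have h2 := mul_le_mul_of_nonneg_left
        (dist_triangle (u (n + (k + 1))) (u (n + k)) (u n)) hε.le
      change f (u (n + (k + 1))) + ε * dist (u (n + (k + 1))) (u (n + k)) ≤ _ at h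
      linarith
  have hanti : Antitone fun n => f (u n) := antitone_nat_of_succ_le fun n => by
    have := hmono n 1
    have h2 : 0 ≤ ε * dist (u (n + 1)) (u n) := by positivity
    linarith
  have hbd : BddBelow (range fun n => f (u n)) :=
    hb.mono (by rintro _ ⟨n, rfl⟩; exact mem_range_self _)
  have hlim := tendsto_atTop_ciInf hanti hbd
  set L := ⨅ n, f (u n)
  have hL : ∀ n, L ≤ f (u n) := fun n => ciInf_le hbd n
  have hdist : ∀ N n, N ≤ n → dist (u n) (u N) ≤ (f (u N) - L) / ε := by
    intro N n hn
    obtain ⟨k, rfl⟩ := Nat.exists_eq_add_of_le hn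
    rw [le_div_iff₀ hε]
    have := hmono N k
    have := hL (N + k)
    linarith
  have hcau : CauchySeq u := by
    refine cauchySeq_of_le_tendsto_0 (fun N => 2 * ((f (u N) - L) / ε)) (fun n m N hn hm => ?_) ?_
    · have := dist_triangle_right (u n) (u m) (u N)
      have := hdist N n hn
      have := hdist N m hm
      linarith
    · have := ((hlim.sub_const L).div_const ε).const_mul 2
      simpa using this
  obtain ⟨x, hx⟩ := cauchySeq_tendsto_of_complete hcau
  have hxn : ∀ n, f x + ε * dist x (u n) ≤ f (u n) := by
    intro n
    have hcl : LowerSemicontinuous fun y => f y + ε * dist y (u n) :=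
      hf.add (Continuous.lowerSemicontinuous (by fun_prop))
    have hc := hcl.isClosed_preimage (f (u n))
    refine hc.mem_of_tendsto hx ?_
    filter_upwards [eventually_ge_atTop n] with m hm
    obtain ⟨k, rfl⟩ := Nat.exists_eq_add_of_le hm
    exact hmono n k
  refine ⟨x, hxn 0, fun y => ?_⟩
  -- A violating `y` lies below every `u n`, so the near-minimality of `u (n + 1)` forces `f x ≤ f
  -- y` in the limit.
  by_contra! hlt
  have key : ∀ n, f x ≤ f y + (1 / 2 : ℝ) ^ n := by
    intro n
    have h1 := hg₂ n (u n) y (by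
      have h2 := mul_le_mul_of_nonneg_left (dist_triangle y x (u n)) hε.le
      have := hxn n
      linarith)
    rw [← hu] at h1
    have h3 := hxn (n + 1)
    have h4 : 0 ≤ ε * dist x (u (n + 1)) := by positivity
    linarith
  have h0 : Tendsto (fun n : ℕ => f y + (1 / 2 : ℝ) ^ n) atTop (𝓝 (f y + 0)) :=
    tendsto_const_nhds.add (tendsto_pow_atTop_nhds_zero_of_lt_one (by norm_num) (by norm_num))
  have h1 := ge_of_tendsto' h0 key
  have : 0 ≤ ε * dist y x := by positivity
  linarith

/-- Near `x`, points can be moved continuously so that `f` decreases at rate `ε` per unit of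
displacement: the weak slope of `f` at `x` is at least `ε`. -/
def Deformable {X : Type*} [TopologicalSpace X] (d : X → X → ℝ) (f : X → ℝ) (x : X) (ε : ℝ) :
    Prop :=
  ∃ U ∈ 𝓝 x, ∃ s₀ > 0, ∃ H : X × ℝ → X, ContinuousOn H (U ×ˢ Icc 0 s₀) ∧
    ∀ y ∈ U, ∀ s ∈ Icc 0 s₀, d (H (y, s)) y ≤ s ∧ f (H (y, s)) ≤ f y - ε * s

/-- A deformation for time `s₀` would lower `f` by `ε' * s₀` over a distance at most `s₀`, more than
the Ekeland inequality permits. -/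
theorem not_deformable_of_ekeland {X : Type*} [MetricSpace X] {f : X → ℝ} {x : X} {ε ε' : ℝ}
    (hε : 0 ≤ ε) (hlt : ε < ε') (h : ∀ y, f x ≤ f y + ε * dist y x) :
    ¬ Deformable dist f x ε' := by
  rintro ⟨U, hU, s₀, hs₀, H, -, hH⟩
  obtain ⟨h1, h2⟩ := hH x (mem_of_mem_nhds hU) s₀ ⟨hs₀.le, le_rfl⟩
  have h3 := h (H (x, s₀))
  have h4 := mul_le_mul_of_nonneg_left h1 hε
  have h5 := mul_lt_mul_of_pos_right hlt hs₀
  linarith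

/-- The data of a local deformation on a ball around `x`. -/
theorem Deformable.exists_ball {X : Type*} [MetricSpace X] {f : X → ℝ} {x : X} {ε : ℝ}
    (h : Deformable dist f x ε) :
    ∃ r > 0, ∃ H : X × ℝ → X, ContinuousOn H (Metric.ball x r ×ˢ Icc 0 r) ∧
      ∀ y ∈ Metric.ball x r, ∀ s ∈ Icc 0 r,
        dist (H (y, s)) y ≤ s ∧ f (H (y, s)) ≤ f y - ε * s := by
  obtain ⟨U, hU, s₀, hs₀, H, hc, hH⟩ := h
  obtain ⟨r, hr, hrU⟩ := Metric.mem_nhds_iff.1 hU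
  have h1 : Metric.ball x (min r s₀) ⊆ U := (Metric.ball_subset_ball (min_le_left _ _)).trans hrU
  have h2 : Icc 0 (min r s₀) ⊆ Icc 0 s₀ := Icc_subset_Icc_right (min_le_right _ _)
  exact ⟨min r s₀, lt_min hr hs₀, H, hc.mono (prod_mono h1 h2),
    fun y hy s hs => hH y (h1 hy) s (h2 hs)⟩

/-- One step of the deformation of a path. -/
theorem exists_deformed_path_step {T X : Type*} [TopologicalSpace T] [MetricSpace X]
    {f : X → ℝ} {ε : ℝ} {x : X} {r : ℝ} {H : X × ℝ → X}
    (hc : ContinuousOn H (Metric.ball x r ×ˢ Icc 0 r))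
    (hH : ∀ y ∈ Metric.ball x r, ∀ s ∈ Icc 0 r,
        dist (H (y, s)) y ≤ s ∧ f (H (y, s)) ≤ f y - ε * s)
    (γ : C(T, X)) (τ : C(T, ℝ)) (hτ : ∀ t, τ t ∈ Icc 0 r)
    {O : Set T} (hO : IsOpen O) (hsub : tsupport τ ⊆ O) (hOγ : ∀ t ∈ O, γ t ∈ Metric.ball x r) :
    ∃ γ' : C(T, X), ∀ t, dist (γ' t) (γ t) ≤ τ t ∧ f (γ' t) ≤ f (γ t) - ε * τ t := by
  classical
  -- Off the support of `τ` the time is `0` and `H` moves nothing, so both branches agree there and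
  -- `g` is continuous.
  let g : T → X := fun t => if t ∈ O then H (γ t, τ t) else γ t
  have hin : ∀ t ∈ O, g t = H (γ t, τ t) := fun t ht => if_pos ht
  have hz : ∀ t, t ∉ tsupport τ → τ t = 0 := fun t ht => image_eq_zero_of_notMem_tsupport ht
  have hout : ∀ t, t ∉ tsupport τ → g t = γ t := by
    intro t ht
    by_cases hO' : t ∈ O
    · rw [hin t hO', hz t ht]
      have := (hH (γ t) (hOγ t hO') 0 ⟨le_rfl, (hτ t).1.trans (hτ t).2⟩).1
      exact dist_le_zero.1 this
    · exact if_neg hO'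
  have hg : Continuous g := by
    rw [continuous_iff_continuousAt]
    intro t
    by_cases ht : t ∈ tsupport τ
    · have hON : O ∈ 𝓝 t := hO.mem_nhds (hsub ht)
      have h1 : ContinuousOn (fun t => H (γ t, τ t)) O :=
        hc.comp (by fun_prop) fun t ht => ⟨hOγ t ht, hτ t⟩
      refine (h1.continuousAt hON).congr ?_
      filter_upwards [hON] with s hs using (hin s hs).symm
    · have hN : (tsupport τ)ᶜ ∈ 𝓝 t := (isClosed_tsupport _).isOpen_compl.mem_nhds ht
      refine γ.continuous.continuousAt.congr ?_
      filter_upwards [hN] with s hs using (hout s hs).symm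
  refine ⟨⟨g, hg⟩, fun t => ?_⟩
  by_cases ht : t ∈ tsupport τ
  · have h1 := hH (γ t) (hOγ t (hsub ht)) (τ t) (hτ t)
    simpa [hin t (hsub ht)] using h1
  · simp [hout t ht, hz t ht]

/-- A path can be pushed down along a compact set of parameters with deformable values. -/
theorem exists_deformed_path {T X : Type*} [TopologicalSpace T] [CompactSpace T] [T2Space T]
    [MetricSpace X] {f : X → ℝ} {ε : ℝ} (hε : 0 ≤ ε) (γ : C(T, X)) {K O : Set T}
    (hK : IsClosed K) (hO : IsOpen O) (hKO : K ⊆ O)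
    (hdef : ∀ t ∈ K, Deformable dist f (γ t) ε) :
    ∃ s₀ > 0, ∀ s ∈ Icc 0 s₀, ∃ γ' : C(T, X), (∀ t ∉ O, γ' t = γ t) ∧
      (∀ t, dist (γ' t) (γ t) ≤ s) ∧ (∀ t, f (γ' t) ≤ f (γ t)) ∧
      ∀ t ∈ K, f (γ' t) ≤ f (γ t) - ε * s := by
  classical
  have hdef' : ∀ t : K, ∃ r > 0, ∃ H : X × ℝ → X,
      ContinuousOn H (Metric.ball (γ t) r ×ˢ Icc 0 r) ∧
      ∀ y ∈ Metric.ball (γ t) r, ∀ s ∈ Icc 0 r,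
        dist (H (y, s)) y ≤ s ∧ f (H (y, s)) ≤ f y - ε * s := fun t => (hdef t t.2).exists_ball
  choose r hr H hHc hH using hdef'
  -- Half radii leave room for composition: the earlier deformations displace a point by at most `s₀
  -- ≤ r i / 2`, so it is still in the ball where `H i` is defined.
  let V : K → Set T := fun t => O ∩ γ ⁻¹' Metric.ball (γ t) (r t / 2)
  have hV : ∀ t, IsOpen (V t) := fun t => hO.inter (Metric.isOpen_ball.preimage γ.continuous)
  have hcov : K ⊆ ⋃ t, V t := fun t ht =>
    mem_iUnion.2 ⟨⟨t, ht⟩, hKO ht, by simpa using half_pos (hr ⟨t, ht⟩)⟩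
  obtain ⟨A, hA⟩ := hK.isCompact.elim_finite_subcover V hV hcov
  have hcov' : K ⊆ ⋃ t : A, V t := fun t ht => by
    obtain ⟨i, hi, h⟩ := mem_iUnion₂.1 (hA ht)
    exact mem_iUnion.2 ⟨⟨i, hi⟩, h⟩
  obtain ⟨χ, hχ⟩ := PartitionOfUnity.exists_isSubordinate hK (fun t : A => V t) (fun t => hV t)
    hcov'
  have hsum : ∀ t, ∑ i, χ i t ≤ 1 := fun t => by
    rw [← finsum_eq_sum_of_fintype]; exact χ.sum_le_one t
  have hsumK : ∀ t ∈ K, ∑ i, χ i t = 1 := fun t ht => by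
    rw [← finsum_eq_sum_of_fintype]; exact χ.sum_eq_one ht
  obtain ⟨s₀, hs₀, hs₀r⟩ : ∃ s₀ > 0, ∀ i : A, s₀ ≤ r i / 2 := by
    have h : ∀ᶠ s in 𝓝[>] (0 : ℝ), ∀ i : A, s ≤ r i / 2 := eventually_all.2 fun i =>
      nhdsWithin_le_nhds (eventually_le_nhds (half_pos (hr i)))
    obtain ⟨s₀, h, h'⟩ := (h.and self_mem_nhdsWithin).exists
    exact ⟨s₀, h', h⟩
  refine ⟨s₀, hs₀, fun s hs => ?_⟩
  -- The local deformations are applied one after another, the `i`-th for time `s * χ i t`. The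
  -- times add up to `s` on `K`.
  have key : ∀ B : Finset A, ∃ γ' : C(T, X), ∀ t, dist (γ' t) (γ t) ≤ s * ∑ i ∈ B, χ i t ∧
      f (γ' t) ≤ f (γ t) - ε * (s * ∑ i ∈ B, χ i t) := by
    intro B
    induction B using Finset.induction_on with
    | empty => exact ⟨γ, by simp⟩
    | insert i B hi ih =>
      obtain ⟨γ₁, h₁⟩ := ih
      have hle : ∀ t, s * ∑ i ∈ B, χ i t ≤ r i / 2 := by
        intro t
        have h2 : ∑ i ∈ B, χ i t ≤ 1 := le_trans (Finset.sum_le_sum_of_subset_of_nonneg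
          (Finset.subset_univ B) fun j _ _ => χ.nonneg j t) (hsum t)
        have h3 := mul_le_mul_of_nonneg_left h2 hs.1
        have := hs₀r i
        linarith [hs.2]
      let τ : C(T, ℝ) := ⟨fun t => s * χ i t, by fun_prop⟩
      have hτ : ∀ t, τ t ∈ Icc 0 (r i) := by
        intro t
        refine ⟨mul_nonneg hs.1 (χ.nonneg i t), ?_⟩
        have h3 := mul_le_mul_of_nonneg_left (χ.le_one i t) hs.1
        have h4 := hs₀r i
        have h5 := hr i
        change s * χ i t ≤ r i
        linarith [hs.2]
      have hsub : tsupport τ ⊆ V i :=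
        (closure_mono (Function.support_const_smul_subset s (χ i))).trans (hχ i)
      obtain ⟨γ₂, h₂⟩ := exists_deformed_path_step (hHc i) (hH i) γ₁ τ hτ (hV i) hsub (by
        intro t ht
        have h5 : dist (γ t) (γ i) < r i / 2 := ht.2
        have h6 := dist_triangle (γ₁ t) (γ t) (γ i)
        have := (h₁ t).1
        have := hle t
        rw [Metric.mem_ball]
        linarith)
      refine ⟨γ₂, fun t => ?_⟩
      rw [Finset.sum_insert hi]
      obtain ⟨a1, a2⟩ := h₁ t
      obtain ⟨b1, b2⟩ := h₂ t
      have h6 := dist_triangle (γ₂ t) (γ₁ t) (γ t)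
      change _ ≤ s * χ i t at b1
      change _ ≤ _ - ε * (s * χ i t) at b2
      constructor
      · rw [mul_add]; linarith
      · rw [mul_add, mul_add]; linarith
  obtain ⟨γ', hγ'⟩ := key Finset.univ
  have hnn : ∀ t, 0 ≤ ∑ i, χ i t := fun t => Finset.sum_nonneg fun i _ => χ.nonneg i t
  refine ⟨γ', fun t ht => ?_, fun t => (hγ' t).1.trans ?_, fun t => (hγ' t).2.trans ?_,
    fun t ht => ?_⟩
  · have h0 : ∀ i, χ i t = 0 := fun i => by
      apply image_eq_zero_of_notMem_tsupport
      exact fun h => ht (hχ i h).1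
    have := (hγ' t).1
    simp only [h0, Finset.sum_const_zero, mul_zero] at this
    exact dist_le_zero.1 this
  · have := mul_le_mul_of_nonneg_left (hsum t) hs.1
    linarith
  · have := mul_nonneg hε (mul_nonneg hs.1 (hnn t))
    linarith
  · have := (hγ' t).2
    rwa [hsumK t ht, mul_one] at this

/-- The mountain pass principle: at the minimax level over the paths from `x₁` to `x₂` there are
points of arbitrarily small weak slope. -/
theorem exists_mountain_pass_level {X : Type*} [MetricSpace X] [CompleteSpace X] {f : X → ℝ}
    (hf : Continuous f) {x₁ x₂ : X} (hj : Joined x₁ x₂) {α : ℝ} (h₁ : f x₁ < α) (h₂ : f x₂ < α)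
    (hα : ∀ γ : C(unitInterval, X), γ 0 = x₁ → γ 1 = x₂ → ∃ t, α ≤ f (γ t)) :
    ∃ c ≥ α, ∀ ε > 0, ∃ x, |f x - c| < ε ∧ ¬ Deformable dist f x ε := by
  let Γ : Set C(unitInterval, X) := {γ | γ 0 = x₁ ∧ γ 1 = x₂}
  have hΓc : IsClosed Γ :=
    (isClosed_eq (continuous_eval_const 0) continuous_const).inter
      (isClosed_eq (continuous_eval_const 1) continuous_const)
  have : CompleteSpace Γ := hΓc.completeSpace_coe
  -- Ekeland's principle is applied on the complete space of paths, to the maximum of `f` along a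
  -- path.
  let Ψ : Γ → ℝ := fun γ => ⨆ t, f (γ.1 t)
  have hbdd : ∀ γ : C(unitInterval, X), BddAbove (range fun t => f (γ t)) := fun γ =>
    (isCompact_range (hf.comp γ.continuous)).bddAbove
  have hle : ∀ (γ : Γ) t, f (γ.1 t) ≤ Ψ γ := fun γ t => le_ciSup (hbdd γ.1) t
  have hΨ : LowerSemicontinuous Ψ := by
    refine lowerSemicontinuous_ciSup (fun γ => hbdd γ.1) fun t => ?_
    exact (hf.comp ((continuous_eval_const t).comp
      continuous_subtype_val)).lowerSemicontinuous
  have hΨα : ∀ γ, α ≤ Ψ γ := fun γ => by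
    obtain ⟨t, ht⟩ := hα γ.1 γ.2.1 γ.2.2
    exact ht.trans (hle γ t)
  have hb : BddBelow (range Ψ) := ⟨α, by rintro _ ⟨γ, rfl⟩; exact hΨα γ⟩
  obtain ⟨γ₀⟩ := hj
  have : Nonempty Γ := ⟨⟨γ₀.toContinuousMap, γ₀.source, γ₀.target⟩⟩
  set c := ⨅ γ, Ψ γ
  have hcα : α ≤ c := le_ciInf hΨα
  refine ⟨c, hcα, fun ε hε => ?_⟩
  by_contra! hno
  have hm : max (f x₁) (f x₂) < α := max_lt h₁ h₂
  -- Parameters within `η` of the maximum take values within `ε` of `c` and stay above the values at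
  -- the endpoints, which the deformation has to fix.
  obtain ⟨η, hη, hηε, hηα⟩ : ∃ η > 0, η < ε ∧ max (f x₁) (f x₂) < α - η :=
    ⟨min (ε / 2) ((α - max (f x₁) (f x₂)) / 2), lt_min (by linarith) (by linarith),
      (min_le_left _ _).trans_lt (by linarith), by
        have := min_le_right (ε / 2) ((α - max (f x₁) (f x₂)) / 2)
        linarith⟩
  obtain ⟨γ₁, hγ₁⟩ := exists_lt_of_ciInf_lt (show c < c + η by linarith)
  obtain ⟨γ, hγ, hγmin⟩ := exists_ekeland_point hΨ hb (half_pos hε) γ₁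
  have hγc : Ψ γ < c + η := by
    have : 0 ≤ ε / 2 * dist γ γ₁ := by positivity
    linarith
  have hcγ : c ≤ Ψ γ := ciInf_le hb γ
  let K : Set unitInterval := {t | Ψ γ - η ≤ f (γ.1 t)}
  let O : Set unitInterval := {t | max (f x₁) (f x₂) < f (γ.1 t)}
  have hfγ : Continuous fun t => f (γ.1 t) := hf.comp γ.1.continuous
  obtain ⟨s₀, hs₀, hdefm⟩ := exists_deformed_path (f := f) hε.le γ.1 (K := K) (O := O)
    (isClosed_le continuous_const hfγ) (isOpen_lt continuous_const hfγ)
    (fun t (ht : Ψ γ - η ≤ f (γ.1 t)) => show max (f x₁) (f x₂) < f (γ.1 t) by linarith)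
    (fun t (ht : Ψ γ - η ≤ f (γ.1 t)) => hno _ (by
      rw [abs_lt]
      constructor
      · linarith
      · linarith [hle γ t]))
  -- With `ε * s ≤ η`, the parameters outside `K`, already `η` below the maximum, also end up below
  -- `Ψ γ - ε * s`. This contradicts the Ekeland inequality with constant `ε / 2`.
  set s := min s₀ (η / ε)
  have hs : 0 < s := lt_min hs₀ (by positivity)
  have hsη : ε * s ≤ η := by
    have : s ≤ η / ε := min_le_right _ _
    rw [le_div_iff₀ hε] at this
    linarith
  obtain ⟨γ', hend, hd, hdec, hdecK⟩ := hdefm s ⟨hs.le, min_le_left _ _⟩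
  have hγ'Γ : γ' ∈ Γ := by
    constructor
    · rw [hend 0 (by simp [O, γ.2.1]), γ.2.1]
    · rw [hend 1 (by simp [O, γ.2.2]), γ.2.2]
  have hlt : Ψ ⟨γ', hγ'Γ⟩ ≤ Ψ γ - ε * s := by
    refine ciSup_le fun t => ?_
    by_cases ht : t ∈ K
    · have := hdecK t ht
      have := hle γ t
      change f (γ' t) ≤ _
      linarith
    · have h3 : f (γ.1 t) < Ψ γ - η := not_le.1 ht
      have := hdec t
      change f (γ' t) ≤ _
      linarith
  have hdist : dist (⟨γ', hγ'Γ⟩ : Γ) γ ≤ s := by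
    rw [Subtype.dist_eq]
    exact (ContinuousMap.dist_le hs.le).2 hd
  have h4 := hγmin ⟨γ', hγ'Γ⟩
  have h5 := mul_le_mul_of_nonneg_left hdist (half_pos hε).le
  have h6 := mul_pos hε hs
  linarith

/-- A minimizing sequence can be replaced by an asymptotic one of vanishing weak slope. -/
theorem exists_near_not_deformable {X : Type*} [MetricSpace X] [CompleteSpace X] {f : X → ℝ}
    (hf : Continuous f) {m : ℝ} (hm : ∀ x, m ≤ f x) {ε : ℝ} (hε : 0 < ε) {y : X}
    (hy : f y < m + ε ^ 2) :
    ∃ x, dist x y < ε ∧ f x ≤ f y ∧ ¬ Deformable dist f x (2 * ε) := by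
  obtain ⟨x, hx, hmin⟩ := exists_ekeland_point hf.lowerSemicontinuous
    ⟨m, by rintro _ ⟨x, rfl⟩; exact hm x⟩ hε y
  refine ⟨x, ?_, ?_, not_deformable_of_ekeland hε.le (by linarith) hmin⟩
  · have := hm x
    by_contra! h
    have := mul_le_mul_of_nonneg_left h hε.le
    nlinarith
  · have : 0 ≤ ε * dist x y := by positivity
    linarith

end Variational


/-! ### Keller calculus: mean value theorem, chain rule, locality. -/

section KellerCalculus

set_option linter.unusedSectionVars false

instance : FrechetSpace ℝ where

variable {E F G : Type*}
  [AddCommGroup E] [Module ℝ E] [UniformSpace E] [FrechetSpace E]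
  [AddCommGroup F] [Module ℝ F] [UniformSpace F] [FrechetSpace F]
  [AddCommGroup G] [Module ℝ G] [UniformSpace G] [FrechetSpace G]

theorem HasDirDeriv.dirDeriv_eq {f : E → F} {x h : E} {v : F} (hf : HasDirDeriv f x h v) :
    dirDeriv f x h = v :=
  Tendsto.limUnder_eq hf

theorem dirDeriv_congr {f g : E → F} {x : E} (hfg : f =ᶠ[𝓝 x] g) (h : E) :
    dirDeriv f x h = dirDeriv g x h := by
  have h1 : Tendsto (fun t : ℝ => x + t • h) (𝓝[≠] 0) (𝓝 x) := by
    have h2 : Continuous fun t : ℝ => x + t • h := by fun_prop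
    simpa using (h2.tendsto 0).mono_left nhdsWithin_le_nhds
  unfold dirDeriv limUnder
  congr 1
  refine Filter.map_congr ?_
  filter_upwards [h1.eventually hfg] with t ht
  rw [ht, hfg.eq_of_nhds]

theorem HasDirDeriv.congr {f g : E → F} {x h : E} {v : F} (hf : HasDirDeriv f x h v)
    (hfg : f =ᶠ[𝓝 x] g) : HasDirDeriv g x h v := by
  have h1 : Tendsto (fun t : ℝ => x + t • h) (𝓝[≠] 0) (𝓝 x) := by
    have h2 : Continuous fun t : ℝ => x + t • h := by fun_prop
    simpa using (h2.tendsto 0).mono_left nhdsWithin_le_nhds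
  refine Tendsto.congr' ?_ hf
  filter_upwards [h1.eventually hfg] with t ht
  rw [ht, hfg.eq_of_nhds]

/-- `f` is `C¹` near `x`: it is continuous with linear directional derivatives, jointly continuous
in the point and the direction. -/
def C1At (f : E → F) (x : E) : Prop :=
  ∀ᶠ y in 𝓝 x, ContinuousAt f y ∧ (∃ L : E →ₗ[ℝ] F, ∀ h, HasDirDeriv f y h (L h)) ∧
    ∀ w, ContinuousAt (fun z : E × E => dirDeriv f z.1 z.2) (y, w)

namespace C1At

variable {f : E → F} {x : E}

theorem eventually (hf : C1At f x) : ∀ᶠ y in 𝓝 x, C1At f y :=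
  eventually_eventually_nhds.2 hf

theorem continuousAt (hf : C1At f x) : ContinuousAt f x := hf.self_of_nhds.1

theorem exists_linear (hf : C1At f x) : ∃ L : E →ₗ[ℝ] F, ∀ h, dirDeriv f x h = L h := by
  obtain ⟨L, hL⟩ := hf.self_of_nhds.2.1
  exact ⟨L, fun h => (hL h).dirDeriv_eq⟩

theorem hasDirDeriv (hf : C1At f x) (h : E) : HasDirDeriv f x h (dirDeriv f x h) := by
  obtain ⟨L, hL⟩ := hf.self_of_nhds.2.1
  rw [(hL h).dirDeriv_eq]
  exact hL h

theorem dirDeriv_smul (hf : C1At f x) (c : ℝ) (h : E) :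
    dirDeriv f x (c • h) = c • dirDeriv f x h := by
  obtain ⟨L, hL⟩ := hf.exists_linear
  rw [hL, hL, map_smul]

theorem dirDeriv_zero (hf : C1At f x) : dirDeriv f x 0 = 0 := by
  obtain ⟨L, hL⟩ := hf.exists_linear
  rw [hL, map_zero]

theorem dirDeriv_neg (hf : C1At f x) (h : E) : dirDeriv f x (-h) = -dirDeriv f x h := by
  obtain ⟨L, hL⟩ := hf.exists_linear
  rw [hL, hL, map_neg]

theorem continuousAt_dirDeriv (hf : C1At f x) (w : E) :
    ContinuousAt (fun z : E × E => dirDeriv f z.1 z.2) (x, w) := hf.self_of_nhds.2.2 w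

theorem tendsto_dirDeriv (hf : C1At f x) {α : Type*} {l : Filter α} {p k : α → E} {w : E}
    (hp : Tendsto p l (𝓝 x)) (hk : Tendsto k l (𝓝 w)) :
    Tendsto (fun t => dirDeriv f (p t) (k t)) l (𝓝 (dirDeriv f x w)) := by
  have h : Tendsto (fun z : E × E => dirDeriv f z.1 z.2) (𝓝 (x, w)) (𝓝 (dirDeriv f x w)) :=
    hf.continuousAt_dirDeriv w
  have h2 := h.comp (hp.prodMk_nhds hk)
  exact h2

theorem congr (hf : C1At f x) {g : E → F} (hfg : f =ᶠ[𝓝 x] g) : C1At g x := by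
  filter_upwards [hf.eventually, hfg.eventually_nhds] with y hy hyg
  refine ⟨hy.continuousAt.congr hyg, ?_, fun w => ?_⟩
  · obtain ⟨L, hL⟩ := hy.exists_linear
    exact ⟨L, fun h => by rw [← hL h]; exact (hy.hasDirDeriv h).congr hyg⟩
  · refine (hy.continuousAt_dirDeriv w).congr ?_
    have h1 : Tendsto (fun z : E × E => z.1) (𝓝 (y, w)) (𝓝 y) := continuous_fst.tendsto _
    filter_upwards [h1.eventually hyg.eventually_nhds] with z hz using dirDeriv_congr hz _

end C1At

theorem exists_isClosed_convex_nhds {v : F} {V : Set F} (hV : V ∈ 𝓝 v) :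
    ∃ C ∈ 𝓝 v, IsClosed C ∧ Convex ℝ C ∧ C ⊆ V := by
  obtain ⟨V', hV', hcl, hsub⟩ := exists_mem_nhds_isClosed_subset hV
  obtain ⟨C, hC, hconv, hCV⟩ :=
    (locallyConvexSpace_iff_exists_convex_subset ℝ F).1 inferInstance v V' hV'
  exact ⟨closure C, mem_of_superset hC subset_closure, isClosed_closure, hconv.closure,
    (closure_minimal hCV hcl).trans hsub⟩

/-- Mean value theorem: an increment along a segment lies in any closed convex set containing the
derivatives along the segment. -/
theorem sub_mem_of_hasDirDeriv {f : E → F} {x h : E} {C : Set F} (hC : IsClosed C)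
    (hconv : Convex ℝ C)
    (hf : ∀ σ ∈ Icc (0 : ℝ) 1, ∃ v ∈ C, HasDirDeriv f (x + σ • h) h v) :
    f (x + h) - f x ∈ C := by
  by_contra hnot
  -- A separating functional reduces the claim to the mean value theorem for a real function of one
  -- variable.
  obtain ⟨l, u, hl, hu⟩ := geometric_hahn_banach_closed_point hconv hC hnot
  choose! v hvC hv using hf
  have hder : ∀ σ ∈ Icc (0 : ℝ) 1, HasDerivAt (fun σ : ℝ => l (f (x + σ • h))) (l (v σ)) σ := by
    intro σ hσ
    rw [hasDerivAt_iff_tendsto_slope_zero]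
    refine ((l.continuous.tendsto _).comp (hv σ hσ)).congr fun t => ?_
    simp only [Function.comp_apply, map_smul, map_sub]
    rw [add_smul, add_assoc]
  obtain ⟨c, hc, hceq⟩ := exists_hasDerivAt_eq_slope (fun σ : ℝ => l (f (x + σ • h)))
    (fun σ => l (v σ)) zero_lt_one
    (fun σ hσ => (hder σ hσ).continuousAt.continuousWithinAt)
    (fun σ hσ => hder σ (Ioo_subset_Icc_self hσ))
  have h1 := hl _ (hvC c (Ioo_subset_Icc_self hc))
  simp only [one_smul, zero_smul, add_zero, sub_zero, div_one] at hceq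
  rw [map_sub] at hu
  linarith

namespace C1At

variable {f : E → F} {x : E}

open scoped Pointwise in
-- Here the direction varies with the parameter, the Hadamard form that the chain rule requires. By
-- joint continuity the derivatives along a short segment lie in a prescribed closed convex
-- neighbourhood, and the mean value theorem transfers this to the difference quotient.
theorem tendsto_slope (hf : C1At f x) {α : Type*} {l : Filter α} {τ : α → ℝ} {k : α → E} {w : E}
    (hτ : Tendsto τ l (𝓝[≠] 0)) (hk : Tendsto k l (𝓝 w)) :
    Tendsto (fun a => (τ a)⁻¹ • (f (x + τ a • k a) - f x)) l (𝓝 (dirDeriv f x w)) := by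
  rw [tendsto_def]
  intro V hV
  obtain ⟨C, hC, hcl, hconv, hCV⟩ := exists_isClosed_convex_nhds hV
  have hev : ∀ᶠ z : E × E in 𝓝 (x, w), C1At f z.1 ∧ dirDeriv f z.1 z.2 ∈ C :=
    ((continuous_fst.tendsto (x, w)).eventually hf.eventually).and
      ((hf.continuousAt_dirDeriv w).eventually hC)
  have hcont : Continuous fun p : ℝ × E => (x + p.1 • p.2, p.2) := by fun_prop
  have hev2 : ∀ᶠ p : ℝ × E in 𝓝 (0, w),
      C1At f (x + p.1 • p.2) ∧ dirDeriv f (x + p.1 • p.2) p.2 ∈ C := by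
    have h0 : Tendsto (fun p : ℝ × E => (x + p.1 • p.2, p.2)) (𝓝 (0, w)) (𝓝 (x, w)) := by
      simpa using hcont.tendsto (0, w)
    exact h0.eventually hev
  rw [nhds_prod_eq] at hev2
  obtain ⟨pa, hpa, pb, hpb, hab⟩ := eventually_prod_iff.1 hev2
  obtain ⟨δ, hδ, hball⟩ := Metric.eventually_nhds_iff.1 hpa
  have hτ0 : ∀ᶠ a in l, dist (τ a) 0 < δ :=
    (hτ.mono_right nhdsWithin_le_nhds).eventually (Metric.ball_mem_nhds 0 hδ)
  have hτne : ∀ᶠ a in l, τ a ≠ 0 := hτ.eventually self_mem_nhdsWithin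
  filter_upwards [hτ0, hτne, hk.eventually hpb] with a ha hne hka
  apply hCV
  have key : f (x + τ a • k a) - f x ∈ τ a • C := by
    refine sub_mem_of_hasDirDeriv (hcl.smul_of_ne_zero hne) (hconv.smul _) fun σ hσ => ?_
    have h1 : dist (σ * τ a) 0 < δ := by
      rw [Real.dist_eq, sub_zero] at ha ⊢
      rw [abs_mul, abs_of_nonneg hσ.1]
      calc σ * |τ a| ≤ 1 * |τ a| := mul_le_mul_of_nonneg_right hσ.2 (abs_nonneg _)
        _ < δ := by rwa [one_mul]
    obtain ⟨h2, h3⟩ := hab (hball h1) hka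
    simp only at h2 h3
    rw [mul_smul] at h2 h3
    refine ⟨τ a • dirDeriv f (x + σ • τ a • k a) (k a), smul_mem_smul_set h3, ?_⟩
    rw [← h2.dirDeriv_smul]
    exact h2.hasDirDeriv _
  rwa [mem_smul_set_iff_inv_smul_mem₀ hne] at key

/-- Chain rule for curves. -/
theorem tendsto_slope_comp {c : ℝ → E} {t : ℝ} (hf : C1At f (c t)) {l : Filter ℝ}
    (hl : l ≤ 𝓝[≠] t) {w : E} (hc : Tendsto (fun s => (s - t)⁻¹ • (c s - c t)) l (𝓝 w)) :
    Tendsto (fun s => (s - t)⁻¹ • (f (c s) - f (c t))) l (𝓝 (dirDeriv f (c t) w)) := by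
  have hτ : Tendsto (fun s : ℝ => s - t) l (𝓝[≠] 0) := by
    refine Tendsto.mono_left ?_ hl
    refine tendsto_nhdsWithin_iff.2 ⟨?_, ?_⟩
    · have : Continuous fun s : ℝ => s - t := by fun_prop
      simpa using (this.tendsto t).mono_left nhdsWithin_le_nhds
    · filter_upwards [self_mem_nhdsWithin] with s hs using sub_ne_zero.2 hs
  refine (hf.tendsto_slope hτ hc).congr' ?_
  filter_upwards [hl self_mem_nhdsWithin] with s hs
  have hs' : s - t ≠ 0 := sub_ne_zero.2 hs
  rw [smul_inv_smul₀ hs', add_sub_cancel]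

theorem hasDirDeriv_comp {g : F → G} (hg : C1At g (f x)) (hf : C1At f x) (h : E) :
    HasDirDeriv (g ∘ f) x h (dirDeriv g (f x) (dirDeriv f x h)) := by
  have h1 := hg.tendsto_slope tendsto_id (hf.hasDirDeriv h)
  refine h1.congr' ?_
  filter_upwards [self_mem_nhdsWithin] with t ht
  have ht' : t ≠ 0 := ht
  simp only [id, Function.comp_apply]
  rw [smul_inv_smul₀ ht', add_sub_cancel]

theorem dirDeriv_comp {g : F → G} (hg : C1At g (f x)) (hf : C1At f x) (h : E) :
    dirDeriv (g ∘ f) x h = dirDeriv g (f x) (dirDeriv f x h) :=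
  (hg.hasDirDeriv_comp hf h).dirDeriv_eq

theorem comp {g : F → G} (hg : C1At g (f x)) (hf : C1At f x) : C1At (g ∘ f) x := by
  have hev : ∀ᶠ y in 𝓝 x, C1At f y ∧ C1At g (f y) :=
    hf.eventually.and (hf.continuousAt.eventually hg.eventually)
  filter_upwards [hev.eventually_nhds] with y hy
  obtain ⟨hfy, hgy⟩ := hy.self_of_nhds
  refine ⟨hgy.continuousAt.comp hfy.continuousAt, ?_, fun w => ?_⟩
  · obtain ⟨L, hL⟩ := hfy.exists_linear
    obtain ⟨L', hL'⟩ := hgy.exists_linear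
    refine ⟨L'.comp L, fun h => ?_⟩
    have := hgy.hasDirDeriv_comp hfy h
    rwa [hL, hL'] at this
  · have h0 : Tendsto (fun z : E × E => f z.1) (𝓝 (y, w)) (𝓝 (f y)) :=
      hfy.continuousAt.tendsto.comp (continuous_fst.tendsto (y, w))
    have h2 : Tendsto (fun z : E × E => dirDeriv g (f z.1) (dirDeriv f z.1 z.2)) (𝓝 (y, w))
        (𝓝 (dirDeriv g (f y) (dirDeriv f y w))) :=
      hgy.tendsto_dirDeriv h0 (hfy.continuousAt_dirDeriv w)
    rw [← hgy.dirDeriv_comp hfy] at h2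
    refine h2.congr' ?_
    filter_upwards [(continuous_fst.tendsto (y, w)).eventually hy] with z hz
    exact (hz.2.dirDeriv_comp hz.1 _).symm

theorem _root_.dirDeriv_id (h : E) : dirDeriv (id : E → E) x h = h := by
  refine HasDirDeriv.dirDeriv_eq ?_
  refine Tendsto.congr' ?_ tendsto_const_nhds
  filter_upwards [self_mem_nhdsWithin] with t ht
  have ht' : t ≠ 0 := ht
  simp [inv_smul_smul₀ ht']

end C1At

/-- Evaluation is jointly sequentially continuous for the compact-open topology. -/
theorem continuousOn_eval_of_continuousOn {f' : E → (E →L_c[ℝ] F)} {U : Set E}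
    (hf' : ContinuousOn f' U) : ContinuousOn (fun z : E × E => f' z.1 z.2) (U ×ˢ univ) := by
  rintro ⟨x, w⟩ ⟨hx, -⟩
  change Tendsto _ _ _
  refine tendsto_of_seq_tendsto fun u hu => ?_
  rw [tendsto_nhdsWithin_iff] at hu
  obtain ⟨hu, huU⟩ := hu
  have h1 : Tendsto (fun n => (u n).1) atTop (𝓝 x) := (continuous_fst.tendsto _).comp hu
  have h2 : Tendsto (fun n => (u n).2) atTop (𝓝 w) := (continuous_snd.tendsto _).comp hu
  have h3 : Tendsto (fun n => f' (u n).1) atTop (𝓝 (f' x)) :=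
    (hf' x hx).tendsto.comp (tendsto_nhdsWithin_iff.2 ⟨h1, huU.mono fun n hn => hn.1⟩)
  -- A convergent sequence with its limit is compact, so compact-open convergence is uniform on it.
  have hK : IsCompact (insert w (range fun n => (u n).2)) := h2.isCompact_insert_range
  have h4 := (UniformConvergenceCLM.tendsto_iff_tendstoUniformlyOn _ _ _).1 h3 _ hK
  refine h4.tendsto_comp (f' x).continuous.continuousWithinAt (tendsto_nhdsWithin_iff.2 ⟨h2, ?_⟩)
  exact Eventually.of_forall fun n => mem_insert_of_mem _ (mem_range_self n)

theorem KellerC1On.c1At {f : E → F} {U : Set E} (hf : KellerC1On f U) (hU : IsOpen U) {x : E}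
    (hx : x ∈ U) : C1At f x := by
  obtain ⟨hc, f', hd, hf'⟩ := hf
  filter_upwards [hU.mem_nhds hx] with y hy
  refine ⟨hc.continuousAt (hU.mem_nhds hy), ⟨(f' y : E →L[ℝ] F), hd y hy⟩, fun w => ?_⟩
  have hN : U ×ˢ (univ : Set E) ∈ 𝓝 (y, w) := prod_mem_nhds (hU.mem_nhds hy) univ_mem
  refine ((continuousOn_eval_of_continuousOn hf').continuousAt hN).congr ?_
  filter_upwards [hN] with z hz using ((hd z.1 hz.1 z.2).dirDeriv_eq).symm

/-- Being Keller `C¹` is a local property. -/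
theorem KellerC1On.of_local {f : E → F} {U : Set E}
    (h : ∀ x ∈ U, ∃ V, IsOpen V ∧ x ∈ V ∧ ∃ g : E → F, EqOn f g V ∧ KellerC1On g (U ∩ V)) :
    KellerC1On f U := by
  choose! V hVo hxV g hfg hg using h
  have hev : ∀ x ∈ U, ∀ y ∈ V x, f =ᶠ[𝓝 y] g x := fun x hx y hy => by
    filter_upwards [(hVo x hx).mem_nhds hy] with z hz using hfg x hx hz
  choose! hc g' hd hg' using hg
  have hNV : ∀ x ∈ U, 𝓝[U ∩ V x] x = 𝓝[U] x := fun x hx =>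
    nhdsWithin_inter_of_mem' (mem_nhdsWithin_of_mem_nhds ((hVo x hx).mem_nhds (hxV x hx)))
  -- Each point uses the derivative from its own local representative; uniqueness of limits makes
  -- these choices agree nearby.
  refine ⟨fun x hx => ?_, fun x => g' x x, fun x hx v => ?_, fun x hx => ?_⟩
  · have h1 := hc x hx x ⟨hx, hxV x hx⟩
    rw [ContinuousWithinAt, hNV x hx] at h1
    exact ContinuousWithinAt.congr_of_eventuallyEq h1
      (mem_nhdsWithin_of_mem_nhds (hev x hx x (hxV x hx))) (hfg x hx (hxV x hx))
  · exact (hd x hx x ⟨hx, hxV x hx⟩ v).congr (hev x hx x (hxV x hx)).symm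
  · have h1 := hg' x hx x ⟨hx, hxV x hx⟩
    rw [ContinuousWithinAt, hNV x hx] at h1
    refine ContinuousWithinAt.congr_of_eventuallyEq h1 ?_ rfl
    filter_upwards [self_mem_nhdsWithin,
      mem_nhdsWithin_of_mem_nhds ((hVo x hx).mem_nhds (hxV x hx))] with y hy hyV
    ext v
    have a := (hd y hy y ⟨hy, hxV y hy⟩ v).congr (hev y hy y (hxV y hy)).symm
    have b := (hd x hx y ⟨hy, hyV⟩ v).congr (hev x hx y hyV).symm
    exact tendsto_nhds_unique a b

end KellerCalculus


/-! ### Changes of charts, tangent vectors and curves. -/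

section Charts

set_option linter.unusedSectionVars false

variable {F M : Type*}
  [AddCommGroup F] [Module ℝ F] [UniformSpace F] [FrechetSpace F]
  [TopologicalSpace M] [ChartedSpace F M]

variable {a b c : OpenPartialHomeomorph M F} {x : M}

theorem symm_tendsto_nhds (ha : x ∈ a.source) : Tendsto a.symm (𝓝 (a x)) (𝓝 x) := by
  simpa [ContinuousAt, a.left_inv ha] using a.continuousAt_symm (a.map_source ha)

theorem eventually_symm_mem (ha : x ∈ a.source) (hb : x ∈ b.source) :
    ∀ᶠ u in 𝓝 (a x), a.symm u ∈ b.source :=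
  (symm_tendsto_nhds ha).eventually (b.open_source.mem_nhds hb)

theorem comp_transition_eventuallyEq (ha : x ∈ a.source) (hb : x ∈ b.source) {Y : Type*}
    (f : M → Y) : (f ∘ b.symm) ∘ (b ∘ a.symm) =ᶠ[𝓝 (a x)] f ∘ a.symm := by
  filter_upwards [eventually_symm_mem ha hb] with u hu
  simp [b.left_inv hu]

/-- The derivative at `x` of the change of coordinates from the chart `a` to the chart `b`. -/
def coordChangeDeriv (a b : OpenPartialHomeomorph M F) (x : M) (w : F) : F :=
  dirDeriv (b ∘ a.symm) (a x) w

/-- `IsC1Chart` compares a chart only with those of the atlas, so the transition is factored through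
the preferred chart at `x`. -/
theorem IsC1Chart.c1At_transition (ha' : IsC1Chart a) (hb' : IsC1Chart b) (ha : x ∈ a.source)
    (hb : x ∈ b.source) : C1At (b ∘ a.symm) (a x) := by
  have hc := mem_chart_source F x
  have h1 : C1At (chartAt F x ∘ a.symm) (a x) :=
    (ha' _ (chart_mem_atlas F x)).1.c1At (a.symm ≫ₕ chartAt F x).open_source
      (by simp [a.left_inv ha, a.map_source ha])
  have h2 : C1At (b ∘ (chartAt F x).symm) (chartAt F x x) :=
    (hb' _ (chart_mem_atlas F x)).2.c1At ((chartAt F x).symm ≫ₕ b).open_source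
      (by simp [hb])
  have h3 : C1At ((b ∘ (chartAt F x).symm) ∘ (chartAt F x ∘ a.symm)) (a x) :=
    C1At.comp (by simpa [a.left_inv ha] using h2) h1
  exact h3.congr (comp_transition_eventuallyEq ha hc b)

theorem C1At.of_chart {G : Type*} [AddCommGroup G] [Module ℝ G] [UniformSpace G] [FrechetSpace G]
    {f : M → G} (hf : C1At (f ∘ b.symm) (b x)) (ha' : IsC1Chart a) (hb' : IsC1Chart b)
    (ha : x ∈ a.source) (hb : x ∈ b.source) : C1At (f ∘ a.symm) (a x) := by
  have h3 : C1At ((f ∘ b.symm) ∘ (b ∘ a.symm)) (a x) :=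
    C1At.comp (by simpa [a.left_inv ha] using hf) (ha'.c1At_transition hb' ha hb)
  exact h3.congr (comp_transition_eventuallyEq ha hb f)

theorem dirDeriv_comp_coordChangeDeriv {G : Type*} [AddCommGroup G] [Module ℝ G] [UniformSpace G]
    [FrechetSpace G] {f : M → G} (hf : C1At (f ∘ b.symm) (b x)) (ha' : IsC1Chart a)
    (hb' : IsC1Chart b) (ha : x ∈ a.source) (hb : x ∈ b.source) (w : F) :
    dirDeriv (f ∘ b.symm) (b x) (coordChangeDeriv a b x w) = dirDeriv (f ∘ a.symm) (a x) w := by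
  have h1 : (b ∘ a.symm) (a x) = b x := by simp [a.left_inv ha]
  have h2 := C1At.dirDeriv_comp (g := f ∘ b.symm) (by rwa [h1])
    (ha'.c1At_transition hb' ha hb) w
  rw [dirDeriv_congr (comp_transition_eventuallyEq ha hb f), h1] at h2
  exact h2.symm

theorem coordChangeDeriv_comp (ha' : IsC1Chart a) (hb' : IsC1Chart b) (hc' : IsC1Chart c)
    (ha : x ∈ a.source) (hb : x ∈ b.source) (hc : x ∈ c.source) (w : F) :
    coordChangeDeriv b c x (coordChangeDeriv a b x w) = coordChangeDeriv a c x w :=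
  dirDeriv_comp_coordChangeDeriv (hb'.c1At_transition hc' hb hc) ha' hb' ha hb w

theorem coordChangeDeriv_self (ha : x ∈ a.source) (w : F) : coordChangeDeriv a a x w = w := by
  have h : a ∘ a.symm =ᶠ[𝓝 (a x)] id := by
    filter_upwards [a.open_target.mem_nhds (a.map_source ha)] with u hu using a.right_inv hu
  rw [coordChangeDeriv, dirDeriv_congr h, dirDeriv_id]

theorem tendsto_coordChangeDeriv (ha' : IsC1Chart a) (hb' : IsC1Chart b)
    (ha : x ∈ a.source) (hb : x ∈ b.source) {α : Type*} {l : Filter α} {p : α → M} {k : α → F}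
    {w : F} (hp : Tendsto p l (𝓝 x)) (hk : Tendsto k l (𝓝 w)) :
    Tendsto (fun t => coordChangeDeriv a b (p t) (k t)) l (𝓝 (coordChangeDeriv a b x w)) :=
  (ha'.c1At_transition hb' ha hb).tendsto_dirDeriv ((a.continuousAt ha).tendsto.comp hp) hk

theorem tangentOfCoord_apply (ha : x ∈ a.source) (w : F) :
    tangentOfCoord a (a x) w = coordChangeDeriv a (chartAt F x) x w := by
  rw [tangentOfCoord, a.left_inv ha, coordChangeDeriv]

variable [FrechetC1Manifold F M]

theorem isC1Chart_of_mem_atlas {e : OpenPartialHomeomorph M F} (he : e ∈ atlas F M) :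
    IsC1Chart e := fun e' he' =>
  ⟨FrechetC1Manifold.compatible e he e' he', FrechetC1Manifold.compatible e' he' e he⟩

theorem isC1Chart_chartAt (x : M) : IsC1Chart (chartAt F x) :=
  isC1Chart_of_mem_atlas (chart_mem_atlas F x)

theorem coordOfTangent_tangentOfCoord (ha' : IsC1Chart a) (hb' : IsC1Chart b)
    (ha : x ∈ a.source) (hb : x ∈ b.source) (w : F) :
    coordOfTangent b x (tangentOfCoord a (a x) w) = coordChangeDeriv a b x w := by
  rw [tangentOfCoord_apply ha]
  exact coordChangeDeriv_comp ha' (isC1Chart_chartAt x) hb' ha (mem_chart_source F x) hb w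

theorem tangentOfCoord_coordOfTangent (ha' : IsC1Chart a) (ha : x ∈ a.source) (h : F) :
    tangentOfCoord a (a x) (coordOfTangent a x h) = h := by
  rw [tangentOfCoord_apply ha]
  have := coordChangeDeriv_comp (isC1Chart_chartAt x) ha' (isC1Chart_chartAt x)
    (mem_chart_source F x) ha (mem_chart_source F x) h
  rwa [coordChangeDeriv_self (mem_chart_source F x)] at this

theorem coordChangeDeriv_coordOfTangent (ha' : IsC1Chart a) (hb' : IsC1Chart b)
    (ha : x ∈ a.source) (hb : x ∈ b.source) (h : F) :
    coordChangeDeriv a b x (coordOfTangent a x h) = coordOfTangent b x h :=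
  coordChangeDeriv_comp (isC1Chart_chartAt x) ha' hb' (mem_chart_source F x) ha hb h

theorem functionalDeriv_tangentOfCoord {J : M → ℝ} (ha' : IsC1Chart a) (ha : x ∈ a.source)
    (hJ : C1At (J ∘ a.symm) (a x)) (w : F) :
    functionalDeriv J x (tangentOfCoord a (a x) w) = dirDeriv (J ∘ a.symm) (a x) w := by
  rw [tangentOfCoord_apply ha]
  exact dirDeriv_comp_coordChangeDeriv
    (hJ.of_chart (isC1Chart_chartAt x) ha' (mem_chart_source F x) ha) ha' (isC1Chart_chartAt x) ha
    (mem_chart_source F x) w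

theorem functionalDeriv_eq {J : M → ℝ} (ha' : IsC1Chart a) (ha : x ∈ a.source)
    (hJ : C1At (J ∘ a.symm) (a x)) (h : F) :
    functionalDeriv J x h = dirDeriv (J ∘ a.symm) (a x) (coordOfTangent a x h) := by
  rw [← functionalDeriv_tangentOfCoord ha' ha hJ, tangentOfCoord_coordOfTangent ha' ha]

/-! ### Curves -/

section Curves

variable {r s : ℝ} {γ : ℝ → M} {v : ℝ → F}

theorem ContinuousOn.eventually_mem_source (hγ : ContinuousOn γ (Icc r s)) {t : ℝ}
    (ht : t ∈ Icc r s) (ha : γ t ∈ a.source) : ∀ᶠ t' in 𝓝[Icc r s] t, γ t' ∈ a.source :=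
  (hγ t ht).eventually (a.open_source.mem_nhds ha)

/-- `IsC1Curve` speaks of atlas charts only, while the charts of the Finsler structure are merely
compatible with the atlas; the chain rule bridges the two. -/
theorem IsC1Curve.tendsto_slope (hγ : IsC1Curve r s γ v) (ha' : IsC1Chart a) {t : ℝ}
    (ht : t ∈ Icc r s) (ha : γ t ∈ a.source) :
    Tendsto (fun t' : ℝ => (t' - t)⁻¹ • (a (γ t') - a (γ t))) (𝓝[Icc r s \ {t}] t)
      (𝓝 (coordOfTangent a (γ t) (v t))) := by
  set c := chartAt F (γ t)
  have hc : γ t ∈ c.source := mem_chart_source F (γ t)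
  have hc' : IsC1Chart c := isC1Chart_chartAt (γ t)
  have h1 := (hγ.2 c (chart_mem_atlas F (γ t))).1 t ⟨ht, hc⟩
  have h2 := C1At.tendsto_slope_comp (c := c ∘ γ) (f := a ∘ c.symm) (t := t)
    (hc'.c1At_transition ha' hc ha)
    (nhdsWithin_mono t (fun t' ht' => ht'.2)) h1
  have h3 : dirDeriv (a ∘ c.symm) ((c ∘ γ) t) (coordOfTangent c (γ t) (v t)) =
      coordOfTangent a (γ t) (v t) := coordChangeDeriv_coordOfTangent hc' ha' hc ha (v t)
  rw [h3] at h2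
  refine h2.congr' ?_
  filter_upwards [nhdsWithin_mono t sdiff_subset (hγ.1.eventually_mem_source ht hc)] with t' ht'
  simp [c.left_inv ht', c.left_inv hc]

theorem IsC1Curve.continuousWithinAt_coordOfTangent (hγ : IsC1Curve r s γ v) (ha' : IsC1Chart a)
    {t : ℝ} (ht : t ∈ Icc r s) (ha : γ t ∈ a.source) :
    ContinuousWithinAt (fun t => coordOfTangent a (γ t) (v t)) (Icc r s) t := by
  set c := chartAt F (γ t)
  have hc : γ t ∈ c.source := mem_chart_source F (γ t)
  have hc' : IsC1Chart c := isC1Chart_chartAt (γ t)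
  have h1 := (hγ.2 c (chart_mem_atlas F (γ t))).2 t ⟨ht, hc⟩
  have hev := hγ.1.eventually_mem_source ht hc
  have hev' := hγ.1.eventually_mem_source ht ha
  rw [ContinuousWithinAt, nhdsWithin_inter_of_mem' (t := γ ⁻¹' c.source) hev] at h1
  have h3 := tendsto_coordChangeDeriv hc' ha' hc ha (hγ.1 t ht).tendsto h1
  rw [coordChangeDeriv_coordOfTangent hc' ha' hc ha (v t)] at h3
  refine h3.congr' ?_
  filter_upwards [hev, hev'] with t' h5 h6
  exact coordChangeDeriv_coordOfTangent hc' ha' h5 h6 (v t')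

theorem GradedFinsler.snorm_eq_coord (S : GradedFinsler F M) (ha' : IsC1Chart a)
    (ha : x ∈ a.source) (n : ℕ) (h : F) :
    S.snorm n x h = S.snorm n (a.symm (a x)) (tangentOfCoord a (a x) (coordOfTangent a x h)) := by
  rw [tangentOfCoord_coordOfTangent ha' ha, a.left_inv ha]

theorem IsC1Curve.continuousOn_snorm (hγ : IsC1Curve r s γ v) (S : GradedFinsler F M) (n : ℕ) :
    ContinuousOn (fun t => S.snorm n (γ t) (v t)) (Icc r s) := by
  intro t ht
  obtain ⟨a, ha', ha, hS⟩ := S.locally_finsler (γ t)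
  have h1 : ContinuousAt
      (fun z : F × F => S.snorm n (a.symm z.1) (tangentOfCoord a z.1 z.2))
      (a (γ t), coordOfTangent a (γ t) (v t)) :=
    (hS.continuousOn n).continuousAt
      (prod_mem_nhds (a.open_target.mem_nhds (a.map_source ha)) univ_mem)
  have h2 : Tendsto (fun t' => (a (γ t'), coordOfTangent a (γ t') (v t'))) (𝓝[Icc r s] t)
      (𝓝 (a (γ t), coordOfTangent a (γ t) (v t))) :=
    ((a.continuousAt ha).tendsto.comp (hγ.1 t ht).tendsto).prodMk_nhds
      (hγ.continuousWithinAt_coordOfTangent ha' ht ha)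
  have h3 := h1.tendsto.comp h2
  rw [← S.snorm_eq_coord ha' ha] at h3
  refine h3.congr' ?_
  filter_upwards [hγ.1.eventually_mem_source ht ha] with t' ht'
  exact (S.snorm_eq_coord ha' ht' n (v t')).symm

/-- A segment in a chart is a `C¹` curve. -/
theorem isC1Curve_segment (ha' : IsC1Chart a) {u w : F}
    (h : ∀ t ∈ Icc (0 : ℝ) 1, u + t • w ∈ a.target) :
    IsC1Curve 0 1 (fun t : ℝ => a.symm (u + t • w))
      (fun t : ℝ => tangentOfCoord a (u + t • w) w) := by
  have hcont : ContinuousOn (fun t : ℝ => a.symm (u + t • w)) (Icc 0 1) :=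
    a.continuousOn_symm.comp (by fun_prop) h
  have hd : ∀ e : OpenPartialHomeomorph M F, IsC1Chart e →
      ∀ t ∈ Icc (0 : ℝ) 1, a.symm (u + t • w) ∈ e.source →
      C1At (e ∘ a.symm) (u + t • w) ∧
      coordOfTangent e (a.symm (u + t • w)) (tangentOfCoord a (u + t • w) w) =
        dirDeriv (e ∘ a.symm) (u + t • w) w := by
    intro e he t ht hte
    have h1 := a.map_target (h t ht)
    have h2 := a.right_inv (h t ht)
    have h3 := ha'.c1At_transition he h1 hte
    have h4 := coordOfTangent_tangentOfCoord ha' he h1 hte w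
    rw [coordChangeDeriv] at h4
    rw [h2] at h3 h4
    exact ⟨h3, h4⟩
  refine ⟨hcont, fun e he => ⟨fun t ⟨ht, hte⟩ => ?_, fun t ⟨ht, hte⟩ => ?_⟩⟩
  · obtain ⟨h1, h2⟩ := hd e (isC1Chart_of_mem_atlas he) t ht hte
    rw [h2]
    refine C1At.tendsto_slope_comp (c := fun t : ℝ => u + t • w) (f := e ∘ a.symm) h1
      (nhdsWithin_mono t (fun t' ht' => ht'.2)) ?_
    refine Tendsto.congr' ?_ tendsto_const_nhds
    filter_upwards [self_mem_nhdsWithin] with t' ht'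
    have hne : t' - t ≠ 0 := sub_ne_zero.2 ht'.2
    rw [add_sub_add_left_eq_sub, ← sub_smul, inv_smul_smul₀ hne]
  · obtain ⟨h1, h2⟩ := hd e (isC1Chart_of_mem_atlas he) t ht hte
    have h3 : Tendsto (fun t : ℝ => u + t • w) (𝓝 t) (𝓝 (u + t • w)) := by
      have : Continuous fun t : ℝ => u + t • w := by fun_prop
      exact this.tendsto t
    have h4 : ContinuousAt (fun t : ℝ => dirDeriv (e ∘ a.symm) (u + t • w) w) t :=
      h1.tendsto_dirDeriv h3 tendsto_const_nhds
    refine h4.continuousWithinAt.congr (fun t' ht' => ?_) h2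
    exact (hd e (isC1Chart_of_mem_atlas he) t' ht'.1 ht'.2).2

/-- The reversed curve. -/
theorem IsC1Curve.reverse (hγ : IsC1Curve r s γ v) :
    IsC1Curve (-s) (-r) (fun t => γ (-t)) (fun t => -v (-t)) := by
  have hmem : ∀ t, t ∈ Icc (-s) (-r) → -t ∈ Icc r s := fun t ht =>
    ⟨by linarith [ht.2], by linarith [ht.1]⟩
  have hneg : ∀ e : OpenPartialHomeomorph M F, IsC1Chart e → ∀ y ∈ e.source, ∀ h : F,
      coordOfTangent e y (-h) = -coordOfTangent e y h := fun e he y hy h =>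
    ((isC1Chart_chartAt y).c1At_transition he (mem_chart_source F y) hy).dirDeriv_neg h
  refine ⟨hγ.1.comp continuous_neg.continuousOn hmem, fun e he => ⟨fun t ⟨ht, hte⟩ => ?_, ?_⟩⟩
  · rw [hneg e (isC1Chart_of_mem_atlas he) _ hte]
    have h1 := (hγ.2 e he).1 (-t) ⟨hmem t ht, hte⟩
    have h2 : Tendsto (fun t' : ℝ => -t') (𝓝[Icc (-s) (-r) \ {t}] t)
        (𝓝[Icc r s \ {-t}] (-t)) := by
      refine tendsto_nhdsWithin_iff.2 ⟨(continuous_neg.tendsto t).mono_left nhdsWithin_le_nhds, ?_⟩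
      filter_upwards [self_mem_nhdsWithin] with t' ht'
      exact ⟨hmem t' ht'.1, fun h => ht'.2 (neg_injective h)⟩
    refine (h1.comp h2).neg.congr fun t' => ?_
    simp only [Function.comp_apply]
    rw [← neg_smul, ← inv_neg]
    congr 2
    ring
  · have h1 : ContinuousOn (fun t => -coordOfTangent e (γ (-t)) (v (-t)))
        (Icc (-s) (-r) ∩ (fun t => γ (-t)) ⁻¹' e.source) :=
      (((hγ.2 e he).2.comp continuous_neg.continuousOn fun t ht => ⟨hmem t ht.1, ht.2⟩)).neg
    exact h1.congr fun t ht => hneg e (isC1Chart_of_mem_atlas he) _ ht.2 _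

end Curves

end Charts


/-! ### The pseudo-distances `ρₙ` and the manifold topology. -/

section FinslerDistance

set_option linter.unusedSectionVars false

variable {F M : Type*}
  [AddCommGroup F] [Module ℝ F] [UniformSpace F] [FrechetSpace F]
  [TopologicalSpace M] [ChartedSpace F M] [FrechetC1Manifold F M]

namespace GradedFinsler

variable (S : GradedFinsler F M) {n : ℕ} {x y z : M} {ℓ ℓ' : ℝ}

variable {S} in
theorem HasPath.nonneg (h : S.HasPath n x y ℓ) : 0 ≤ ℓ := by
  induction h with
  | nil => exact le_rfl
  | snoc hp a b hab γ v hγ ha ih =>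
    exact add_nonneg ih (intervalIntegral.integral_nonneg hab fun t _ => apply_nonneg _ _)

variable {S} in
theorem HasPath.trans (h : S.HasPath n x y ℓ) (h' : S.HasPath n y z ℓ') :
    S.HasPath n x z (ℓ + ℓ') := by
  induction h' with
  | nil => simpa using h
  | snoc hp a b hab γ v hγ ha ih =>
    rw [← add_assoc]
    exact ih.snoc a b hab γ v hγ ha

variable {S} in
theorem HasPath.symm (h : S.HasPath n x y ℓ) : S.HasPath n y x ℓ := by
  induction h with
  | nil => exact .nil
  | @snoc y ℓ hp a b hab γ v hγ ha ih =>
    have h1 := (HasPath.nil (S := S) (n := n) (x := γ b)).snoc (-b) (-a) (by linarith)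
      (fun t => γ (-t)) (fun t => -v (-t)) hγ.reverse (by simp)
    simp only [neg_neg, ha, map_neg_eq_map, zero_add] at h1
    rw [intervalIntegral.integral_comp_neg (fun t => S.snorm n (γ t) (v t)), neg_neg, neg_neg] at h1
    rw [add_comm]
    exact h1.trans ih

theorem bddBelow_lengths (n : ℕ) (x y : M) : BddBelow {ℓ : ℝ | S.HasPath n x y ℓ} :=
  ⟨0, fun _ h => h.nonneg⟩

variable {S} in
theorem HasPath.distN_le (h : S.HasPath n x y ℓ) : S.distN n x y ≤ ℓ :=
  csInf_le (S.bddBelow_lengths n x y) h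

theorem distN_nonneg (n : ℕ) (x y : M) : 0 ≤ S.distN n x y :=
  Real.sInf_nonneg fun _ h => HasPath.nonneg h

theorem distN_self (n : ℕ) (x : M) : S.distN n x x = 0 :=
  le_antisymm HasPath.nil.distN_le (S.distN_nonneg n x x)

theorem distN_comm (n : ℕ) (x y : M) : S.distN n x y = S.distN n y x := by
  unfold distN
  congr 1
  ext ℓ
  exact ⟨HasPath.symm, HasPath.symm⟩

theorem exists_hasPath_segment {a : OpenPartialHomeomorph M F} (ha : IsC1Chart a) {u w : F}
    (h : ∀ t ∈ Icc (0 : ℝ) 1, u + t • w ∈ a.target) {C : ℝ}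
    (hC : ∀ t ∈ Icc (0 : ℝ) 1, S.snorm n (a.symm (u + t • w)) (tangentOfCoord a (u + t • w) w) ≤ C) :
    ∃ ℓ ≤ C, S.HasPath n (a.symm u) (a.symm (u + w)) ℓ := by
  have hγ := isC1Curve_segment ha h
  have h1 := (HasPath.nil (S := S) (n := n) (x := a.symm u)).snoc 0 1 zero_le_one _ _ hγ (by simp)
  simp only [one_smul, zero_add] at h1
  refine ⟨_, ?_, h1⟩
  have h2 : IntervalIntegrable
      (fun t : ℝ => S.snorm n (a.symm (u + t • w)) (tangentOfCoord a (u + t • w) w))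
      MeasureTheory.volume 0 1 := by
    refine ContinuousOn.intervalIntegrable ?_
    rw [uIcc_of_le zero_le_one]
    exact hγ.continuousOn_snorm S n
  have h3 := intervalIntegral.integral_mono_on zero_le_one h2
    (intervalIntegrable_const (c := C)) hC
  simpa using h3

theorem distN_segment_le {a : OpenPartialHomeomorph M F} (ha : IsC1Chart a) {u w : F}
    (h : ∀ t ∈ Icc (0 : ℝ) 1, u + t • w ∈ a.target) {C : ℝ}
    (hC : ∀ t ∈ Icc (0 : ℝ) 1, S.snorm n (a.symm (u + t • w)) (tangentOfCoord a (u + t • w) w) ≤ C) :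
    S.distN n (a.symm u) (a.symm (u + w)) ≤ C := by
  obtain ⟨ℓ, hℓ, hp⟩ := S.exists_hasPath_segment ha h hC
  exact hp.distN_le.trans hℓ

theorem _root_.exists_convex_nhds_subset {U : Set F} {u : F} (hU : U ∈ 𝓝 u) :
    ∃ C ∈ 𝓝 u, Convex ℝ C ∧ C ⊆ U :=
  (locallyConvexSpace_iff_exists_convex_subset ℝ F).1 inferInstance u U hU

theorem eventually_exists_hasPath (n : ℕ) (x : M) : ∀ᶠ y in 𝓝 x, ∃ ℓ, S.HasPath n x y ℓ := by
  set a := chartAt F x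
  have ha : x ∈ a.source := mem_chart_source F x
  have ha' : IsC1Chart a := isC1Chart_chartAt x
  obtain ⟨C, hC, hconv, hCt⟩ := exists_convex_nhds_subset (a.open_target.mem_nhds (a.map_source ha))
  filter_upwards [a.open_source.mem_nhds ha, (a.continuousAt ha).eventually hC] with y hy hyC
  have hseg : ∀ t ∈ Icc (0 : ℝ) 1, a x + t • (a y - a x) ∈ a.target := fun t ht =>
    hCt (hconv.add_smul_sub_mem (mem_of_mem_nhds hC) hyC ht)
  have hcont := (isC1Curve_segment ha' hseg).continuousOn_snorm S n
  obtain ⟨B, hB⟩ := (isCompact_Icc.image_of_continuousOn hcont).bddAbove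
  obtain ⟨ℓ, -, hp⟩ := S.exists_hasPath_segment ha' hseg fun t ht => hB (mem_image_of_mem _ ht)
  rw [add_sub_cancel, a.left_inv ha, a.left_inv hy] at hp
  exact ⟨ℓ, hp⟩

/-- The set of reachable points is open and closed. This excludes an infimum over the empty set,
whose default value `0` would spoil `distN`. -/
theorem exists_hasPath [ConnectedSpace M] (n : ℕ) (x y : M) : ∃ ℓ, S.HasPath n x y ℓ := by
  let R : Set M := {y | ∃ ℓ, S.HasPath n x y ℓ}
  have hopen : IsOpen R := isOpen_iff_mem_nhds.2 fun y ⟨ℓ, hy⟩ => by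
    filter_upwards [S.eventually_exists_hasPath n y] with z ⟨ℓ', hz⟩ using ⟨_, hy.trans hz⟩
  have hclosed : IsClosed R := by
    refine isClosed_of_closure_subset fun y hy => ?_
    obtain ⟨z, ⟨ℓ, hz⟩, ℓ', hz'⟩ :=
      mem_closure_iff_nhds.1 hy _ (S.eventually_exists_hasPath n y)
    exact ⟨_, hz'.trans hz.symm⟩
  have huniv : R = univ := IsClopen.eq_univ ⟨hclosed, hopen⟩ ⟨x, 0, .nil⟩
  have : y ∈ R := huniv ▸ mem_univ y
  exact this

theorem exists_hasPath_of_distN_lt [ConnectedSpace M] {r : ℝ} (h : S.distN n x y < r) :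
    ∃ ℓ < r, S.HasPath n x y ℓ := by
  obtain ⟨ℓ, h1, h2⟩ := exists_lt_of_csInf_lt (S.exists_hasPath n x y) h
  exact ⟨ℓ, h2, h1⟩

theorem distN_triangle [ConnectedSpace M] (n : ℕ) (x y z : M) :
    S.distN n x z ≤ S.distN n x y + S.distN n y z := by
  refine le_of_forall_pos_le_add fun ε hε => ?_
  obtain ⟨ℓ, hℓ, h⟩ := S.exists_hasPath_of_distN_lt
    (show S.distN n x y < S.distN n x y + ε / 2 by linarith)
  obtain ⟨ℓ', hℓ', h'⟩ := S.exists_hasPath_of_distN_lt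
    (show S.distN n y z < S.distN n y z + ε / 2 by linarith)
  have := (h.trans h').distN_le
  linarith

/-- A chart `a` around `x` in which, over the neighbourhood `W` of `a x`, the Finsler structure is
comparable, with factor `2` and uniformly in the index, to the seminorms `s` at `x`. -/
structure IsNormalChart (x : M) (a : OpenPartialHomeomorph M F) (s : SeminormFamily ℝ F ℕ)
    (W : Set F) : Prop where
  isC1Chart : IsC1Chart a
  mem_source : x ∈ a.source
  withSeminorms : WithSeminorms s
  mono : Monotone s
  mem_nhds : W ∈ 𝓝 (a x)
  subset_target : W ⊆ a.target
  le_snorm : ∀ u ∈ W, ∀ n w, s n w ≤ 2 * S.snorm n (a.symm u) (tangentOfCoord a u w)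
  snorm_le : ∀ u ∈ W, ∀ n w, S.snorm n (a.symm u) (tangentOfCoord a u w) ≤ 2 * s n w

theorem exists_isNormalChart (x : M) : ∃ a s W, S.IsNormalChart x a s W := by
  obtain ⟨a, ha', ha, hS⟩ := S.locally_finsler x
  have hat := a.map_source ha
  obtain ⟨s, hs, hws⟩ := hS.seminorms (a x) hat
  have hev := hS.locally_equiv (a x) hat 2 one_lt_two
  rw [a.open_target.nhdsWithin_eq hat] at hev
  refine ⟨a, s, {u | u ∈ a.target ∧ _}, ha', ha, hws, fun m n hmn w => ?_,
    inter_mem (a.open_target.mem_nhds hat) hev, fun u hu => hu.1, fun u hu n w => ?_, fun u hu n w => ?_⟩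
  · rw [hs, hs]
    exact S.graded _ hmn _
  · have := (hu.2 n w).1
    rw [← hs] at this
    linarith
  · have := (hu.2 n w).2
    rwa [← hs] at this

variable {S}

namespace IsNormalChart

variable {a : OpenPartialHomeomorph M F} {s : SeminormFamily ℝ F ℕ} {W : Set F}

theorem inter (h : S.IsNormalChart x a s W) {W' : Set F} (hW' : W' ∈ 𝓝 (a x)) :
    S.IsNormalChart x a s (W ∩ W') where
  __ := h
  mem_nhds := inter_mem h.mem_nhds hW'
  subset_target := inter_subset_left.trans h.subset_target
  le_snorm u hu := h.le_snorm u hu.1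
  snorm_le u hu := h.snorm_le u hu.1

theorem exists_ball_subset (h : S.IsNormalChart x a s W) :
    ∃ n, ∃ r > 0, ∀ u, s n (u - a x) < r → u ∈ W := by
  obtain ⟨i, r, hr, hsub⟩ := (h.withSeminorms.mem_nhds_iff _ _).1 h.mem_nhds
  -- The seminorms increase, so the one with the largest index dominates the finite supremum.
  refine ⟨i.sup id, r, hr, fun u hu => hsub ?_⟩
  rw [Seminorm.mem_ball]
  have hle : i.sup s ≤ s (i.sup id) := Finset.sup_le fun j hj => h.mono (Finset.le_sup (f := id) hj)
  exact (hle _).trans_lt hu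

theorem eventually_distN_le (h : S.IsNormalChart x a s W) :
    ∀ᶠ y in 𝓝 x, ∀ n, S.distN n x y ≤ 2 * s n (a y - a x) := by
  obtain ⟨C, hC, hconv, hCW⟩ := exists_convex_nhds_subset h.mem_nhds
  have hx := h.mem_source
  filter_upwards [a.open_source.mem_nhds hx, (a.continuousAt hx).eventually hC] with y hy hyC n
  have hseg : ∀ t ∈ Icc (0 : ℝ) 1, a x + t • (a y - a x) ∈ W := fun t ht =>
    hCW (hconv.add_smul_sub_mem (mem_of_mem_nhds hC) hyC ht)
  have := S.distN_segment_le (n := n) h.isC1Chart (fun t ht => h.subset_target (hseg t ht))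
    fun t ht => h.snorm_le _ (hseg t ht) n _
  rwa [add_sub_cancel, a.left_inv hx, a.left_inv hy] at this

/-- A continuous linear functional norming a vector for a given continuous seminorm. -/
theorem _root_.Seminorm.exists_norming_functional {p : Seminorm ℝ F} (hp : Continuous p) (z : F) :
    ∃ l : F →L[ℝ] ℝ, l z = p z ∧ ∀ w, l w ≤ p w := by
  by_cases hz : z = 0
  · exact ⟨0, by simp [hz], fun w => by simp⟩
  let f : F →ₗ.[ℝ] ℝ := LinearPMap.mkSpanSingleton z (p z) hz
  obtain ⟨g, hg, hgp⟩ := Module.Dual.exists_extension_of_le_seminorm_real f.domain f.toFun (p := p)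
    (by
      rintro ⟨y, hy⟩
      obtain ⟨c, rfl⟩ := Submodule.mem_span_singleton.1 hy
      change f ⟨c • z, hy⟩ ≤ p (c • z)
      rw [LinearPMap.mkSpanSingleton'_apply, map_smul_eq_mul, smul_eq_mul]
      exact mul_le_mul_of_nonneg_right (le_abs_self c) (apply_nonneg p z))
  have hcont : Continuous g := by
    refine continuous_of_continuousAt_zero g ?_
    rw [ContinuousAt, map_zero]
    refine squeeze_zero_norm hgp ?_
    simpa using hp.tendsto 0
  refine ⟨⟨g, hcont⟩, ?_, fun w => (le_abs_self _).trans (hgp w)⟩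
  have h1 := hg ⟨z, Submodule.mem_span_singleton_self z⟩
  have h2 : f ⟨z, Submodule.mem_span_singleton_self z⟩ = p z :=
    LinearPMap.mkSpanSingleton_apply ℝ ℝ hz (p z)
  exact h1.trans h2

/-- In a normal chart, coordinate increments along a curve are bounded by its length. -/
theorem seminorm_sub_le (h : S.IsNormalChart x a s W) {b c b' c' : ℝ} {γ : ℝ → M} {v : ℝ → F}
    (hγ : IsC1Curve b c γ v) (hb : b ≤ b') (hbc : b' ≤ c') (hc : c' ≤ c)
    (hW : ∀ t ∈ Icc b' c', γ t ∈ a.source ∧ a (γ t) ∈ W) (m : ℕ) :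
    s m (a (γ c') - a (γ b')) ≤ 2 * ∫ t in b'..c', S.snorm m (γ t) (v t) := by
  -- A norming functional reduces the bound to a scalar function whose right derivative is at most
  -- twice the speed.
  obtain ⟨l, hl, hle⟩ := Seminorm.exists_norming_functional
    (h.withSeminorms.continuous_seminorm m) (a (γ c') - a (γ b'))
  have hsub : Icc b' c' ⊆ Icc b c := Icc_subset_Icc hb hc
  rw [← hl, map_sub, ← intervalIntegral.integral_const_mul]
  have hcontS : ContinuousOn (fun t => 2 * S.snorm m (γ t) (v t)) (Icc b' c') :=
    continuousOn_const.mul ((hγ.continuousOn_snorm S m).mono hsub)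
  refine intervalIntegral.sub_le_integral_of_hasDeriv_right_of_le
    (g' := fun t => l (coordOfTangent a (γ t) (v t))) hbc
    (l.continuous.comp_continuousOn (a.continuousOn.comp (hγ.1.mono hsub) fun t ht => (hW t ht).1))
    (fun t ht => ?_) (hcontS.integrableOn_compact isCompact_Icc) (fun t ht => ?_)
  · have ht' : t ∈ Icc b' c' := Ioo_subset_Icc_self ht
    rw [hasDerivWithinAt_iff_tendsto_slope]
    have h1 := (l.continuous.tendsto _).comp
      (hγ.tendsto_slope h.isC1Chart (hsub ht') (hW t ht').1)
    have h2 : 𝓝[Ioi t \ {t}] t ≤ 𝓝[Icc b c \ {t}] t := by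
      rw [sdiff_singleton_eq_self (by simp)]
      refine nhdsWithin_le_iff.2 ?_
      filter_upwards [Ioo_mem_nhdsGT ht.2] with t' ht''
      exact ⟨hsub ⟨ht.1.le.trans ht''.1.le, ht''.2.le⟩, ht''.1.ne'⟩
    refine (h1.mono_left h2).congr fun t' => ?_
    simp [slope_def_field, div_eq_inv_mul]
  · have ht' : t ∈ Icc b' c' := Ioo_subset_Icc_self ht
    obtain ⟨h1, h2⟩ := hW t ht'
    refine (hle _).trans ((h.le_snorm _ h2 m _).trans_eq ?_)
    rw [← S.snorm_eq_coord h.isC1Chart h1]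

/-- A curve which is too short to leave a coordinate ball stays in it. -/
theorem curve_mem_source [T2Space M] (h : S.IsNormalChart x a s W) {n : ℕ} {r : ℝ}
    (hr : ∀ u, s n (u - a x) < r → u ∈ W) {b c : ℝ} (hbc : b ≤ c) {γ : ℝ → M} {v : ℝ → F}
    (hγ : IsC1Curve b c γ v) (hb : γ b ∈ a.source) {ℓ : ℝ} (hℓ : s n (a (γ b) - a x) ≤ 2 * ℓ)
    (hlt : 2 * (ℓ + ∫ t in b..c, S.snorm n (γ t) (v t)) < r) :
    γ c ∈ a.source ∧ s n (a (γ c) - a x) ≤ 2 * (ℓ + ∫ t in b..c, S.snorm n (γ t) (v t)) := by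
  set V : Set M := a.source ∩ a ⁻¹' {u | s n (u - a x) < r}
  have hball : IsOpen {u | s n (u - a x) < r} :=
    isOpen_lt ((h.withSeminorms.continuous_seminorm n).comp (continuous_sub_right _))
      continuous_const
  have hVo : IsOpen V := a.continuousOn.isOpen_inter_preimage a.open_source hball
  have hVW : ∀ y ∈ V, y ∈ a.source ∧ a y ∈ W := fun y hy => ⟨hy.1, hr _ hy.2⟩
  have hcS : ∀ m, ContinuousOn (fun t => S.snorm m (γ t) (v t)) (Icc b c) :=
    fun m => hγ.continuousOn_snorm S m
  have hint : ∀ m b' c', b ≤ b' → b' ≤ c' → c' ≤ c → IntervalIntegrable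
      (fun t => S.snorm m (γ t) (v t)) MeasureTheory.volume b' c' := fun m b' c' h1 h2 h3 => by
    refine ContinuousOn.intervalIntegrable ?_
    rw [uIcc_of_le h2]
    exact (hcS m).mono (Icc_subset_Icc h1 h3)
  have hbound : ∀ c' ∈ Icc b c, (∀ t ∈ Icc b c', γ t ∈ V) →
      s n (a (γ c') - a x) ≤ 2 * (ℓ + ∫ t in b..c, S.snorm n (γ t) (v t)) := by
    intro c' hc' hV
    have h1 := h.seminorm_sub_le hγ le_rfl hc'.1 hc'.2 (fun t ht => hVW _ (hV t ht)) n
    have h2 := map_add_le_add (s n) (a (γ c') - a (γ b)) (a (γ b) - a x)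
    rw [sub_add_sub_cancel] at h2
    have h3 := intervalIntegral.integral_add_adjacent_intervals
      (hint n b c' le_rfl hc'.1 hc'.2) (hint n c' c hc'.1 hc'.2 le_rfl)
    have h4 : 0 ≤ ∫ t in c'..c, S.snorm n (γ t) (v t) :=
      intervalIntegral.integral_nonneg hc'.2 fun t _ => apply_nonneg _ _
    linarith
  have h0 : 0 ≤ ∫ t in b..c, S.snorm n (γ t) (v t) :=
    intervalIntegral.integral_nonneg hbc fun t _ => apply_nonneg _ _
  have hbV : γ b ∈ V := ⟨hb, show s n (a (γ b) - a x) < r by linarith⟩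
  suffices hall : ∀ t ∈ Icc b c, γ t ∈ V from
    ⟨(hall c ⟨hbc, le_rfl⟩).1, hbound c ⟨hbc, le_rfl⟩ hall⟩
  by_contra! hex
  have hbad : IsCompact (Icc b c ∩ γ ⁻¹' Vᶜ) :=
    isCompact_Icc.of_isClosed_subset
      (hγ.1.preimage_isClosed_of_isClosed isClosed_Icc hVo.isClosed_compl) inter_subset_left
  obtain ⟨τ, ⟨hτ, hτV⟩, hmin⟩ := hbad.exists_isLeast
    (by obtain ⟨t, ht, htV⟩ := hex; exact ⟨t, ht, htV⟩)
  have hgood : ∀ t ∈ Ico b τ, γ t ∈ V := fun t ht => by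
    by_contra hnot
    exact absurd (hmin ⟨⟨ht.1, ht.2.le.trans hτ.2⟩, hnot⟩) (not_le.2 ht.2)
  have hbτ : b < τ := lt_of_le_of_ne hτ.1 fun heq => hτV (heq ▸ hbV)
  -- The coordinates converge at the exit time, by completeness of the model space.
  set L : Filter ℝ := 𝓝[Ico b τ] τ
  have hL : L.NeBot := by
    rw [← mem_closure_iff_nhdsWithin_neBot, closure_Ico hbτ.ne]
    exact ⟨hbτ.le, le_rfl⟩
  have hLmem : ∀ᶠ t in L, t ∈ Ico b τ := self_mem_nhdsWithin
  have hcau : Cauchy (map (a ∘ γ) L) := by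
    rw [cauchy_map_iff, uniformity_eq_comap_nhds_zero, tendsto_comap_iff]
    refine ⟨hL, ?_⟩
    rw [h.withSeminorms.tendsto_nhds]
    -- The ball is measured by the single index `n`, yet Cauchyness is needed in every seminorm. It
    -- holds because the comparison over `W` is uniform in the index.
    intro m ε hε
    let Φ : ℝ → ℝ := fun t => ∫ t in b..t, S.snorm m (γ t) (v t)
    have hΦ : ContinuousOn Φ (Icc b c) := by
      have := intervalIntegral.continuousOn_primitive_interval
        (f := fun t => S.snorm m (γ t) (v t)) (a := b) (b := c) (μ := MeasureTheory.volume) (by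
          rw [uIcc_of_le hbc]
          exact (hcS m).integrableOn_compact isCompact_Icc)
      rwa [uIcc_of_le hbc] at this
    have hΦL : Tendsto Φ L (𝓝 (Φ τ)) :=
      (hΦ τ hτ).mono_left (nhdsWithin_mono _ fun t ht => ⟨ht.1, ht.2.le.trans hτ.2⟩)
    have hdiff : Tendsto (fun q : ℝ × ℝ => 2 * |Φ q.2 - Φ q.1|) (L ×ˢ L) (𝓝 0) := by
      have := (((hΦL.comp tendsto_snd).sub (hΦL.comp tendsto_fst)).abs).const_mul 2
      simpa using this
    have hincr : ∀ p q, p ∈ Ico b τ → q ∈ Ico b τ → p ≤ q →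
        s m (a (γ q) - a (γ p)) ≤ 2 * |Φ q - Φ p| := by
      intro p q hp hq hpq
      have h1 := h.seminorm_sub_le hγ hp.1 hpq (hq.2.le.trans hτ.2)
        (fun t ht => hVW _ (hgood t ⟨hp.1.trans ht.1, ht.2.trans_lt hq.2⟩)) m
      have h2 := intervalIntegral.integral_add_adjacent_intervals
        (hint m b p le_rfl hp.1 (hp.2.le.trans hτ.2))
        (hint m p q hp.1 hpq (hq.2.le.trans hτ.2))
      have h3 : ∫ t in p..q, S.snorm m (γ t) (v t) = Φ q - Φ p := by
        simp only [Φ]; linarith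
      rw [h3] at h1
      exact h1.trans (mul_le_mul_of_nonneg_left (le_abs_self _) zero_le_two)
    filter_upwards [hLmem.prod_mk hLmem, hdiff.eventually (gt_mem_nhds hε)] with q hq hqε
    simp only [Function.comp_apply, sub_zero]
    refine lt_of_le_of_lt ?_ hqε
    rcases le_total q.1 q.2 with hle | hle
    · exact hincr _ _ hq.1 hq.2 hle
    · rw [map_sub_rev, abs_sub_comm]
      exact hincr _ _ hq.2 hq.1 hle
  obtain ⟨u, hu⟩ := CompleteSpace.complete hcau
  have hu' : Tendsto (fun t => a (γ t)) L (𝓝 u) := hu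
  have hur : s n (u - a x) < r := by
    refine lt_of_le_of_lt ?_ hlt
    have h1 : Tendsto (fun t => s n (a (γ t) - a x)) L (𝓝 (s n (u - a x))) :=
      ((h.withSeminorms.continuous_seminorm n).tendsto _).comp (hu'.sub_const _)
    refine le_of_tendsto h1 ?_
    filter_upwards [hLmem] with t ht
    exact hbound t ⟨ht.1, ht.2.le.trans hτ.2⟩ fun t' ht' => hgood t' ⟨ht'.1, ht'.2.trans_lt ht.2⟩
  have hut : u ∈ a.target := h.subset_target (hr u hur)
  -- The limit in coordinates is still in the ball, and as `M` is Hausdorff it represents `γ τ`, so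
  -- there was no exit.
  have h1 : Tendsto γ L (𝓝 (a.symm u)) := by
    refine ((a.continuousAt_symm hut).tendsto.comp hu').congr' ?_
    filter_upwards [hLmem] with t ht using a.left_inv (hgood t ht).1
  have h2 : Tendsto γ L (𝓝 (γ τ)) :=
    (hγ.1 τ hτ).mono_left (nhdsWithin_mono _ fun t ht => ⟨ht.1, ht.2.le.trans hτ.2⟩)
  apply hτV
  rw [tendsto_nhds_unique h2 h1]
  refine ⟨a.map_target hut, ?_⟩
  change s n (a (a.symm u) - a x) < r
  rwa [a.right_inv hut]

theorem mem_source_of_hasPath [T2Space M] (h : S.IsNormalChart x a s W) {n : ℕ} {r : ℝ}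
    (hr : ∀ u, s n (u - a x) < r → u ∈ W) {y : M} {ℓ : ℝ} (hp : S.HasPath n x y ℓ)
    (hℓ : 2 * ℓ < r) : y ∈ a.source ∧ s n (a y - a x) ≤ 2 * ℓ := by
  induction hp with
  | nil => simpa using h.mem_source
  | snoc hp b c hbc γ v hγ hb ih =>
    have h0 : 0 ≤ ∫ t in b..c, S.snorm n (γ t) (v t) :=
      intervalIntegral.integral_nonneg hbc fun t _ => apply_nonneg _ _
    obtain ⟨h1, h2⟩ := ih (by linarith)
    subst hb
    exact h.curve_mem_source hr hbc hγ h1 h2 hℓ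

end IsNormalChart

variable (S)

/-- A path of `n`-length below `r / 2` cannot leave the coordinate ball of radius `r`, because of
the factor `2` of a normal chart. -/
theorem exists_distN_lt_subset [ConnectedSpace M] [T2Space M] {U : Set M} (hU : U ∈ 𝓝 x) :
    ∃ n, ∃ r > 0, ∀ y, S.distN n x y < r → y ∈ U := by
  obtain ⟨a, s, W, h⟩ := S.exists_isNormalChart x
  have h' := h.inter ((symm_tendsto_nhds h.mem_source).eventually hU)
  obtain ⟨n, r, hr, hsub⟩ := h'.exists_ball_subset
  refine ⟨n, r / 2, half_pos hr, fun y hy => ?_⟩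
  obtain ⟨ℓ, hℓ, hp⟩ := S.exists_hasPath_of_distN_lt hy
  obtain ⟨h1, h2⟩ := h'.mem_source_of_hasPath hsub hp (by linarith)
  have h3 := (hsub (a y) (by linarith)).2
  have h4 : a.symm (a y) ∈ U := h3
  rwa [a.left_inv h1] at h4

theorem tendsto_distN (n : ℕ) (x : M) : Tendsto (S.distN n x) (𝓝 x) (𝓝 0) := by
  obtain ⟨a, s, W, h⟩ := S.exists_isNormalChart x
  have hx := h.mem_source
  have h1 : Tendsto (fun y => 2 * s n (a y - a x)) (𝓝 x) (𝓝 0) := by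
    have h2 := ((h.withSeminorms.continuous_seminorm n).tendsto 0).comp
      (tendsto_sub_nhds_zero_iff.2 (a.continuousAt hx).tendsto)
    simpa using h2.const_mul 2
  refine squeeze_zero' (Eventually.of_forall fun y => S.distN_nonneg n x y) ?_ h1
  filter_upwards [h.eventually_distN_le] with y hy using hy n

end GradedFinsler

end FinslerDistance


/-! ### Rescaled Finsler metrics: topology and completeness. -/

section WeightedMetric

set_option linter.unusedSectionVars false

variable {F M : Type*}
  [AddCommGroup F] [Module ℝ F] [UniformSpace F] [FrechetSpace F]
  [TopologicalSpace M] [ChartedSpace F M] [FrechetC1Manifold F M]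

namespace GradedFinsler

variable (S : GradedFinsler F M)

/-- A rescaled version of the Finsler metric: `∑ₙ min (2⁻ⁿ) (wₙ ρₙ)`. -/
def weightedDist (w : ℕ → ℝ) (x y : M) : ℝ :=
  ∑' n : ℕ, min ((1 / 2 : ℝ) ^ n) (w n * S.distN n x y)

variable {w : ℕ → ℝ} (hw : ∀ n, 0 < w n)

include hw in
theorem weightedTerm_nonneg (n : ℕ) (x y : M) :
    0 ≤ min ((1 / 2 : ℝ) ^ n) (w n * S.distN n x y) :=
  le_min (by positivity) (mul_nonneg (hw n).le (S.distN_nonneg n x y))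

include hw in
theorem summable_weightedDist (x y : M) :
    Summable fun n : ℕ => min ((1 / 2 : ℝ) ^ n) (w n * S.distN n x y) :=
  Summable.of_nonneg_of_le (S.weightedTerm_nonneg hw · x y) (fun _ => min_le_left _ _)
    summable_geometric_two

include hw in
theorem weightedDist_nonneg (x y : M) : 0 ≤ S.weightedDist w x y :=
  tsum_nonneg (S.weightedTerm_nonneg hw · x y)

theorem weightedDist_self (x : M) : S.weightedDist w x x = 0 := by
  simp [weightedDist, S.distN_self]

theorem weightedDist_comm (x y : M) : S.weightedDist w x y = S.weightedDist w y x := by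
  simp only [weightedDist, S.distN_comm _ x y]

include hw in
theorem weightedDist_triangle [ConnectedSpace M] (x y z : M) :
    S.weightedDist w x z ≤ S.weightedDist w x y + S.weightedDist w y z := by
  rw [weightedDist, weightedDist, weightedDist,
    ← (S.summable_weightedDist hw x y).tsum_add (S.summable_weightedDist hw y z)]
  refine (S.summable_weightedDist hw x z).tsum_le_tsum (fun n => ?_)
    ((S.summable_weightedDist hw x y).add (S.summable_weightedDist hw y z))
  have h1 := mul_le_mul_of_nonneg_left (S.distN_triangle n x y z) (hw n).le
  rw [mul_add] at h1
  have h2 := mul_nonneg (hw n).le (S.distN_nonneg n x y)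
  have h3 := mul_nonneg (hw n).le (S.distN_nonneg n y z)
  have h4 : (0 : ℝ) < (1 / 2) ^ n := by positivity
  rcases min_choice ((1 / 2 : ℝ) ^ n) (w n * S.distN n x y) with h | h <;>
  rcases min_choice ((1 / 2 : ℝ) ^ n) (w n * S.distN n y z) with h' | h' <;>
  rw [h, h']
  · exact (min_le_left _ _).trans (by linarith)
  · exact (min_le_left _ _).trans (by linarith)
  · exact (min_le_left _ _).trans (by linarith)
  · exact (min_le_right _ _).trans h1

include hw in
theorem min_le_weightedDist (n : ℕ) (x y : M) :
    min ((1 / 2 : ℝ) ^ n) (w n * S.distN n x y) ≤ S.weightedDist w x y :=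
  (S.summable_weightedDist hw x y).le_tsum n fun k _ => S.weightedTerm_nonneg hw k x y

include hw in
-- In use, `s` is a time and `P n` bounds the speed in the `n`-th seminorm, so `K` bounds the
-- weighted speed.
theorem weightedDist_le {x y : M} {P : ℕ → ℝ} {s K : ℝ} (h : ∀ n, S.distN n x y ≤ s * P n)
    (hs : 0 ≤ s) (hP : Summable fun n => w n * P n) (hK : ∑' n, w n * P n ≤ K) :
    S.weightedDist w x y ≤ s * K := by
  refine le_trans ?_ (mul_le_mul_of_nonneg_left hK hs)
  rw [← tsum_mul_left]
  refine (S.summable_weightedDist hw x y).tsum_le_tsum (fun n => ?_) (hP.mul_left s)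
  refine (min_le_right _ _).trans ?_
  have := mul_le_mul_of_nonneg_left (h n) (hw n).le
  linarith

include hw in
theorem tendsto_weightedDist {ι : Type*} {l : Filter ι} {u v : ι → M}
    (h : ∀ n, Tendsto (fun i => S.distN n (u i) (v i)) l (𝓝 0)) :
    Tendsto (fun i => S.weightedDist w (u i) (v i)) l (𝓝 0) := by
  have h1 := tendsto_tsum_of_dominated_convergence (𝓕 := l) (g := fun _ : ℕ => (0 : ℝ))
    (f := fun i n => min ((1 / 2 : ℝ) ^ n) (w n * S.distN n (u i) (v i)))
    (bound := fun n => (1 / 2 : ℝ) ^ n) summable_geometric_two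
    (fun n => by
      have h2 := (tendsto_const_nhds (x := (1 / 2 : ℝ) ^ n)).min ((h n).const_mul (w n))
      rwa [mul_zero, min_eq_right (by positivity)] at h2)
    (Eventually.of_forall fun i n => by
      rw [Real.norm_of_nonneg (S.weightedTerm_nonneg hw n _ _)]
      exact min_le_left _ _)
  rw [tsum_zero] at h1
  exact h1

include hw in
theorem tendsto_distN_of_weightedDist {ι : Type*} {l : Filter ι} {u v : ι → M}
    (h : Tendsto (fun i => S.weightedDist w (u i) (v i)) l (𝓝 0)) (n : ℕ) :
    Tendsto (fun i => S.distN n (u i) (v i)) l (𝓝 0) := by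
  have h1 : Tendsto (fun i => w n * S.distN n (u i) (v i)) l (𝓝 0) := by
    refine squeeze_zero' (Eventually.of_forall fun i =>
      mul_nonneg (hw n).le (S.distN_nonneg n _ _)) ?_ h
    have h4 : (0 : ℝ) < (1 / 2) ^ n := by positivity
    filter_upwards [h.eventually (gt_mem_nhds h4)] with i hi
    have h5 := S.min_le_weightedDist hw n (u i) (v i)
    rcases min_le_iff.1 h5 with h6 | h6
    · linarith
    · exact h6
  have h2 := h1.const_mul (w n)⁻¹
  simpa [inv_mul_cancel_left₀ (hw n).ne'] using h2

/-- The Finsler and the weighted distances each tend to `0` exactly when all `ρₙ` do, so the two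
have the same Cauchy sequences and completeness carries over. -/
theorem tendsto_finslerDist {ι : Type*} {l : Filter ι} {u v : ι → M}
    (h : ∀ n, Tendsto (fun i => S.distN n (u i) (v i)) l (𝓝 0)) :
    Tendsto (fun i => S.finslerDist (u i) (v i)) l (𝓝 0) := by
  have h1 := tendsto_tsum_of_dominated_convergence (𝓕 := l) (g := fun _ : ℕ => (0 : ℝ))
    (f := fun i n => (1 / 2 : ℝ) ^ (n + 1) *
      (S.distN n (u i) (v i) / (1 + S.distN n (u i) (v i))))
    (bound := fun n => (1 / 2 : ℝ) ^ (n + 1)) ((summable_nat_add_iff 1).2 summable_geometric_two)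
    (fun n => by
      have h2 := ((h n).div ((h n).const_add 1) (by norm_num)).const_mul ((1 / 2 : ℝ) ^ (n + 1))
      simpa using h2)
    (Eventually.of_forall fun i n => by
      have h3 := S.distN_nonneg n (u i) (v i)
      rw [Real.norm_of_nonneg (by positivity)]
      refine mul_le_of_le_one_right (by positivity) ?_
      rw [div_le_one (by positivity)]
      linarith)
  rw [tsum_zero] at h1
  exact h1

theorem tendsto_distN_of_finslerDist {ι : Type*} {l : Filter ι} {u v : ι → M}
    (h : Tendsto (fun i => S.finslerDist (u i) (v i)) l (𝓝 0)) (n : ℕ) :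
    Tendsto (fun i => S.distN n (u i) (v i)) l (𝓝 0) := by
  have hq : ∀ m x y, 0 ≤ S.distN m x y / (1 + S.distN m x y) ∧
      S.distN m x y / (1 + S.distN m x y) < 1 := fun m x y => by
    have h3 := S.distN_nonneg m x y
    exact ⟨by positivity, by rw [div_lt_one (by positivity)]; linarith⟩
  have hsum : ∀ x y, Summable fun m : ℕ =>
      (1 / 2 : ℝ) ^ (m + 1) * (S.distN m x y / (1 + S.distN m x y)) := fun x y =>
    Summable.of_nonneg_of_le (fun m => mul_nonneg (by positivity) (hq m x y).1)
      (fun m => mul_le_of_le_one_right (by positivity) (hq m x y).2.le)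
      ((summable_nat_add_iff 1).2 summable_geometric_two)
  have h1 : Tendsto (fun i => S.distN n (u i) (v i) / (1 + S.distN n (u i) (v i))) l (𝓝 0) := by
    have h2 : Tendsto (fun i => (1 / 2 : ℝ) ^ (n + 1) *
        (S.distN n (u i) (v i) / (1 + S.distN n (u i) (v i)))) l (𝓝 0) :=
      squeeze_zero (fun i => mul_nonneg (by positivity) (hq n _ _).1)
        (fun i => (hsum (u i) (v i)).le_tsum n fun m _ => mul_nonneg (by positivity) (hq m _ _).1) h
    have h4 := h2.const_mul ((1 / 2 : ℝ) ^ (n + 1))⁻¹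
    have h5 : ((1 / 2 : ℝ) ^ (n + 1)) ≠ 0 := by positivity
    simpa only [inv_mul_cancel_left₀ h5, mul_zero] using h4
  -- The map `r ↦ r / (1 - r)` inverts `ρₙ ↦ ρₙ / (1 + ρₙ)`.
  have h6 := h1.div (h1.const_sub 1) (by norm_num)
  rw [sub_zero, zero_div] at h6
  refine h6.congr fun i => ?_
  have h3 := S.distN_nonneg n (u i) (v i)
  have h7 : 1 + S.distN n (u i) (v i) ≠ 0 := by positivity
  rw [Pi.div_apply]
  field_simp
  ring

variable [ConnectedSpace M] [T2Space M]

/-- Convergence of all the pseudo-distances implies convergence. -/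
theorem tendsto_of_tendsto_distN {ι : Type*} {l : Filter ι} {u : ι → M} {x : M}
    (h : ∀ n, Tendsto (fun i => S.distN n x (u i)) l (𝓝 0)) : Tendsto u l (𝓝 x) := by
  intro U hU
  rw [mem_map]
  obtain ⟨n, r, hr, hsub⟩ := S.exists_distN_lt_subset hU
  filter_upwards [(h n).eventually (gt_mem_nhds hr)] with i hi using hsub _ hi

include hw in
theorem isOpen_iff_weightedDist (U : Set M) :
    IsOpen U ↔ ∀ x ∈ U, ∃ ε > 0, ∀ y, S.weightedDist w x y < ε → y ∈ U := by
  rw [isOpen_iff_mem_nhds]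
  refine forall₂_congr fun x _ => ⟨fun hU => ?_, ?_⟩
  · by_contra! hno
    choose! y hy hyU using hno
    have h1 : Tendsto y (𝓝[>] 0) (𝓝 x) := by
      refine S.tendsto_of_tendsto_distN (S.tendsto_distN_of_weightedDist hw (u := fun _ => x) ?_)
      refine squeeze_zero' (Eventually.of_forall fun i => S.weightedDist_nonneg hw _ _) ?_
        (tendsto_id.mono_left nhdsWithin_le_nhds)
      filter_upwards [self_mem_nhdsWithin] with ε hε using (hy ε hε).le
    obtain ⟨ε, hε, hε'⟩ := ((h1.eventually hU).and self_mem_nhdsWithin).exists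
    exact hyU ε hε' hε
  · rintro ⟨ε, hε, hsub⟩
    have h1 : Tendsto (fun y => S.weightedDist w x y) (𝓝 x) (𝓝 0) :=
      S.tendsto_weightedDist hw fun n => S.tendsto_distN n x
    filter_upwards [h1.eventually (gt_mem_nhds hε)] with y hy using hsub y hy

/-- The metric space structure on `M` given by the weighted distance. -/
abbrev weightedMetric : MetricSpace M :=
  MetricSpace.ofDistTopology (S.weightedDist w) S.weightedDist_self S.weightedDist_comm
    (S.weightedDist_triangle hw) (S.isOpen_iff_weightedDist hw) fun x y hxy => by
      have h1 : Tendsto (fun _ : ℕ => y) atTop (𝓝 x) :=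
        S.tendsto_of_tendsto_distN (S.tendsto_distN_of_weightedDist hw (u := fun _ => x)
          (by simp [hxy]))
      exact tendsto_nhds_unique h1 tendsto_const_nhds

theorem completeSpace_weightedMetric (hS : S.IsCompleteMetric) :
    letI := S.weightedMetric hw; CompleteSpace M := by
  let := S.weightedMetric hw
  refine Metric.complete_of_cauchySeq_tendsto fun u hu => ?_
  have h1 : Tendsto (fun p : ℕ × ℕ => S.weightedDist w (u p.1) (u p.2)) (atTop ×ˢ atTop) (𝓝 0) := by
    rw [cauchySeq_iff_tendsto_dist_atTop_0] at hu
    rwa [prod_atTop_atTop_eq]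
  have h2 := S.tendsto_finslerDist (S.tendsto_distN_of_weightedDist hw h1)
  obtain ⟨x, hx⟩ := hS u fun ε hε => by
    have h3 := h2.eventually (gt_mem_nhds hε)
    rw [prod_atTop_atTop_eq, eventually_atTop] at h3
    obtain ⟨⟨K, K'⟩, hK⟩ := h3
    exact ⟨max K K', fun i hi j hj =>
      hK (i, j) ⟨(le_max_left _ _).trans hi, (le_max_right _ _).trans hj⟩⟩
  refine ⟨x, S.tendsto_of_tendsto_distN fun n => ?_⟩
  simp only [S.distN_comm n x]
  exact S.tendsto_distN_of_finslerDist hx n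

end GradedFinsler

end WeightedMetric


/-! ### Choice of weights, and critical points as limits of points of small weak slope. -/

section PalaisSmale

set_option linter.unusedSectionVars false

/-- Countably many sequences become summable after multiplication by suitable weights. -/
theorem exists_summable_weights {ι : Type*} [Countable ι] (a : ι → ℕ → ℝ) (ha : ∀ i n, 0 ≤ a i n) :
    ∃ w : ℕ → ℝ, (∀ n, 0 < w n) ∧ (∀ n, w n ≤ (1 / 2) ^ n) ∧
      ∀ i, Summable fun n => w n * a i n := by
  have := Encodable.ofCountable ι
  let b : ℕ → ℕ → ℝ := fun k n => (Encodable.decode (α := ι) k).elim 0 fun i => a i n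
  have hb : ∀ k n, 0 ≤ b k n := fun k n => by
    simp only [b]
    cases Encodable.decode (α := ι) k with
    | none => exact le_rfl
    | some i => exact ha i n
  -- Diagonal choice: `c n` dominates the `n`-th terms of the sequences numbered `0` to `n`, hence
  -- each sequence eventually.
  let c : ℕ → ℝ := fun n => 1 + ∑ k ∈ Finset.range (n + 1), b k n
  have hc : ∀ n, 1 ≤ c n := fun n => by
    have := Finset.sum_nonneg fun k (_ : k ∈ Finset.range (n + 1)) => hb k n
    simp only [c]
    linarith
  have hc0 : ∀ n, 0 < c n := fun n => one_pos.trans_le (hc n)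
  refine ⟨fun n => (1 / 2) ^ n / c n, fun n => div_pos (by positivity) (hc0 n),
    fun n => div_le_self (by positivity) (hc n), fun i => ?_⟩
  refine summable_geometric_two.of_norm_bounded_eventually_nat ?_
  filter_upwards [eventually_ge_atTop (Encodable.encode i)] with n hn
  have h1 : a i n ≤ c n := by
    have h2 := Finset.single_le_sum (fun k (_ : k ∈ Finset.range (n + 1)) => hb k n)
      (Finset.mem_range.2 (Nat.lt_succ_of_le hn))
    have h3 : b (Encodable.encode i) n = a i n := by simp [b]
    simp only [c]
    linarith
  have h4 : 0 ≤ (1 / 2 : ℝ) ^ n / c n := (div_pos (by positivity) (hc0 n)).le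
  rw [Real.norm_of_nonneg (mul_nonneg h4 (ha i n)), div_mul_eq_mul_div, div_le_iff₀ (hc0 n)]
  exact mul_le_mul_of_nonneg_left h1 (by positivity)

variable {F M : Type*}
  [AddCommGroup F] [Module ℝ F] [UniformSpace F] [FrechetSpace F]
  [TopologicalSpace M] [ChartedSpace F M] [FrechetC1Manifold F M]

theorem tangentOfCoord_smul {a : OpenPartialHomeomorph M F} (ha : IsC1Chart a) {u : F}
    (hu : u ∈ a.target) (c : ℝ) (h : F) :
    tangentOfCoord a u (c • h) = c • tangentOfCoord a u h := by
  have h1 := ha.c1At_transition (isC1Chart_chartAt (a.symm u)) (a.map_target hu)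
    (mem_chart_source F (a.symm u))
  rw [a.right_inv hu] at h1
  exact h1.dirDeriv_smul c h

/-- By continuity `l` vanishes on all of `a.target`, and a linear form that vanishes on a nonempty
open set is zero. -/
theorem eq_zero_of_forall_dense {a : OpenPartialHomeomorph M F} {Q : Set M} (hQ : Dense Q) {x : M}
    (hx : x ∈ a.source) (l : F →L[ℝ] ℝ) (hl : ∀ q ∈ Q, l (a q) = 0) : l = 0 := by
  have h0 : ∀ u ∈ a.target, l u = 0 := by
    by_contra! hne
    obtain ⟨u, hu, hne⟩ := hne
    have ho : IsOpen (a.source ∩ a ⁻¹' {v | l v ≠ 0}) :=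
      a.continuousOn.isOpen_inter_preimage a.open_source
        (isOpen_ne_fun l.continuous continuous_const)
    obtain ⟨q, hq, hqQ⟩ := hQ.inter_open_nonempty _ ho
      ⟨a.symm u, a.map_target hu, by simpa [a.right_inv hu] using hne⟩
    exact hq.2 (hl q hqQ)
  ext h
  have h1 : Tendsto (fun t : ℝ => a x + t • h) (𝓝[≠] 0) (𝓝 (a x)) := by
    have h2 : Continuous fun t : ℝ => a x + t • h := by fun_prop
    simpa using (h2.tendsto 0).mono_left nhdsWithin_le_nhds
  obtain ⟨t, ht, htne⟩ := ((h1.eventually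
    (a.open_target.mem_nhds (a.map_source hx))).and self_mem_nhdsWithin).exists
  have h3 := h0 _ ht
  rw [map_add, h0 _ (a.map_source hx), zero_add, map_smul, smul_eq_mul] at h3
  simpa [show t ≠ 0 from htne] using h3

theorem C1At.exists_continuousLinear {G : Type*} [AddCommGroup G] [Module ℝ G] [UniformSpace G]
    [FrechetSpace G] {f : F → G} {u : F} (hf : C1At f u) :
    ∃ l : F →L[ℝ] G, ∀ h, dirDeriv f u h = l h := by
  obtain ⟨L, hL⟩ := hf.exists_linear
  have hc : Continuous L := by
    rw [continuous_iff_continuousAt]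
    intro h
    have h1 := hf.tendsto_dirDeriv (tendsto_const_nhds (x := u)) (tendsto_id (x := 𝓝 h))
    simp only [hL] at h1
    exact h1
  exact ⟨⟨L, hc⟩, hL⟩

theorem continuous_of_c1At {J : M → ℝ}
    (hJ : ∀ x, C1At (J ∘ (chartAt F x).symm) (chartAt F x x)) : Continuous J := by
  rw [continuous_iff_continuousAt]
  intro x
  have hx := mem_chart_source F x
  have h1 := (hJ x).continuousAt.tendsto.comp ((chartAt F x).continuousAt hx).tendsto
  have h2 : (J ∘ (chartAt F x).symm) ∘ chartAt F x =ᶠ[𝓝 x] J := by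
    filter_upwards [(chartAt F x).open_source.mem_nhds hx] with y hy
    simp [(chartAt F x).left_inv hy]
  have h3 := h1.congr' h2
  simpa [ContinuousAt, (chartAt F x).left_inv hx] using h3

namespace GradedFinsler

variable (S : GradedFinsler F M)

/-- There are weights for which the tangent vectors of finite weighted norm are dense. -/
theorem exists_spanning_weights [SecondCountableTopology M] :
    ∃ w : ℕ → ℝ, (∀ n, 0 < w n) ∧ (∀ n, w n ≤ (1 / 2) ^ n) ∧
      ∀ p : M, ∃ x a s W, S.IsNormalChart x a s W ∧ p ∈ a.source ∧ W ∈ 𝓝 (a p) ∧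
        ∀ l : F →L[ℝ] ℝ, (∀ h, Summable (fun n => w n * s n h) → l h = 0) → l = 0 := by
  choose a s W hN using S.exists_isNormalChart
  let O : M → Set M := fun x => (a x).source ∩ a x ⁻¹' interior (W x)
  have hO : ∀ x, O x ∈ 𝓝 x := fun x =>
    inter_mem ((a x).open_source.mem_nhds (hN x).mem_source)
      (((a x).continuousAt (hN x).mem_source) (interior_mem_nhds.2 (hN x).mem_nhds))
  obtain ⟨T, hT, hTO⟩ := TopologicalSpace.countable_cover_nhds hO
  obtain ⟨Q, hQ, hQd⟩ := TopologicalSpace.exists_countable_dense M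
  have := hT.to_subtype
  have := hQ.to_subtype
  -- Countably many normal charts cover `M`, and `Q` is countable and dense. The weights give finite
  -- weighted norm to the coordinate vector of every point of `Q` in each of these charts.
  obtain ⟨w, hw, hw', hsum⟩ := exists_summable_weights
    (fun (i : T × Q) n => s i.1 n (a i.1 i.2)) (fun i n => apply_nonneg _ _)
  refine ⟨w, hw, hw', fun p => ?_⟩
  have hp : p ∈ ⋃ x ∈ T, O x := hTO ▸ mem_univ p
  obtain ⟨x, hx, hpx⟩ := mem_iUnion₂.1 hp
  refine ⟨x, a x, s x, W x, hN x, hpx.1, mem_interior_iff_mem_nhds.1 hpx.2, fun l hl => ?_⟩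
  exact eq_zero_of_forall_dense hQd (hN x).mem_source l fun q hq =>
    hl _ (hsum (⟨x, hx⟩, ⟨q, hq⟩))

variable {S} {w : ℕ → ℝ} (hw : ∀ n, 0 < w n)

include hw in
/-- A direction of descent provides a local deformation. -/
theorem deformable_of_dirDeriv_lt {a : OpenPartialHomeomorph M F} (ha : IsC1Chart a) {x : M}
    (hx : x ∈ a.source) {J : M → ℝ} (hJ : C1At (J ∘ a.symm) (a x)) {h : F} {P : ℕ → ℝ}
    (hP : ∀ᶠ u in 𝓝 (a x), ∀ n, S.snorm n (a.symm u) (tangentOfCoord a u h) ≤ P n)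
    (hsum : Summable fun n => w n * P n) {K : ℝ} (hK : ∑' n, w n * P n ≤ K) (hK0 : 0 < K) {ε : ℝ}
    (hlt : dirDeriv (J ∘ a.symm) (a x) h < -(ε * K)) :
    Deformable (S.weightedDist w) J x ε := by
  have hD : ∀ᶠ u in 𝓝 (a x), dirDeriv (J ∘ a.symm) u h < -(ε * K) :=
    (hJ.tendsto_dirDeriv tendsto_id tendsto_const_nhds).eventually (gt_mem_nhds hlt)
  have hG := (hJ.eventually.and (a.open_target.mem_nhds (a.map_source hx))).and (hP.and hD)
  have hcont : Continuous fun p : ℝ × F => p.2 + p.1 • h := by fun_prop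
  have h0 : Tendsto (fun p : ℝ × F => p.2 + p.1 • h) (𝓝 0 ×ˢ 𝓝 (a x)) (𝓝 (a x)) := by
    rw [← nhds_prod_eq]
    simpa using hcont.tendsto (0, a x)
  obtain ⟨pa, hpa, pb, hpb, hab⟩ := eventually_prod_iff.1 (h0.eventually hG)
  obtain ⟨δ, hδ, hball⟩ := Metric.eventually_nhds_iff.1 hpa
  let U : Set M := {y | y ∈ a.source ∧ pb (a y)}
  have hU : U ∈ 𝓝 x := inter_mem (a.open_source.mem_nhds hx) ((a.continuousAt hx).eventually hpb)
  have hs₀ : 0 < K * (δ / 2) := by positivity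
  have hθ : ∀ s ∈ Icc 0 (K * (δ / 2)), s / K ∈ Icc 0 (δ / 2) := fun s hs =>
    ⟨div_nonneg hs.1 hK0.le, by rw [div_le_iff₀ hK0]; linarith [hs.2]⟩
  have key : ∀ y ∈ U, ∀ s ∈ Icc 0 (K * (δ / 2)), ∀ t ∈ Icc (0 : ℝ) 1,
      (C1At (J ∘ a.symm) (a y + t • (s / K) • h) ∧ a y + t • (s / K) • h ∈ a.target) ∧
      (∀ n, S.snorm n (a.symm (a y + t • (s / K) • h))
        (tangentOfCoord a (a y + t • (s / K) • h) h) ≤ P n) ∧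
      dirDeriv (J ∘ a.symm) (a y + t • (s / K) • h) h < -(ε * K) := by
    intro y hy s hs t ht
    have h1 := hθ s hs
    have h2 : t * (s / K) ≤ 1 * (s / K) := mul_le_mul_of_nonneg_right ht.2 h1.1
    have h3 : dist (t * (s / K)) 0 < δ := by
      rw [Real.dist_eq, sub_zero, abs_of_nonneg (mul_nonneg ht.1 h1.1)]
      linarith [h1.2]
    have h4 := hab (hball h3) hy.2
    rw [smul_smul]
    exact h4
  -- All points move in the fixed coordinate direction `h`. Its weighted speed is at most `K`, so
  -- time is divided by `K`; the rate of descent `ε * K` then becomes `ε`.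
  refine ⟨U, hU, K * (δ / 2), hs₀, fun z => a.symm (a z.1 + (z.2 / K) • h), ?_, fun y hy s hs => ?_⟩
  · refine a.continuousOn_symm.comp ?_ fun z hz => ?_
    · have h1 : ContinuousOn (fun z : M × ℝ => a z.1) (U ×ˢ Icc 0 (K * (δ / 2))) :=
        a.continuousOn.comp continuousOn_fst fun z hz => hz.1.1
      exact h1.add (Continuous.continuousOn (by fun_prop))
    · have := (key z.1 hz.1 z.2 hz.2 1 (by simp)).1.2
      rwa [one_smul] at this
  · have hsK := (hθ s hs).1
    constructor
    · rw [S.weightedDist_comm]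
      have h1 : ∀ n, S.distN n y (a.symm (a y + (s / K) • h)) ≤ s / K * P n := fun n => by
        have h2 := S.distN_segment_le (n := n) (C := s / K * P n) ha
          (fun t ht => (key y hy s hs t ht).1.2) fun t ht => by
            obtain ⟨⟨-, h3⟩, h4, -⟩ := key y hy s hs t ht
            rw [tangentOfCoord_smul ha h3, map_smul_eq_mul, Real.norm_of_nonneg hsK]
            exact mul_le_mul_of_nonneg_left (h4 n) hsK
        rwa [a.left_inv hy.1] at h2
      have h5 := S.weightedDist_le hw h1 hsK hsum hK
      rwa [div_mul_cancel₀ _ hK0.ne'] at h5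
    · have h1 := sub_mem_of_hasDirDeriv (f := J ∘ a.symm) (x := a y) (h := (s / K) • h)
        (isClosed_Iic (a := -(ε * s))) (convex_Iic _) fun t ht => by
          obtain ⟨⟨h3, -⟩, -, h4⟩ := key y hy s hs t ht
          refine ⟨_, ?_, h3.hasDirDeriv _⟩
          rw [h3.dirDeriv_smul, smul_eq_mul, mem_Iic]
          have h5 := mul_le_mul_of_nonneg_left h4.le hsK
          have h6 : s / K * -(ε * K) = -(ε * s) := by field_simp
          linarith
      simp only [Function.comp_apply, a.left_inv hy.1, mem_Iic] at h1
      linarith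

include hw in
-- This lets the Palais–Smale hypothesis act on points of small weak slope. A vector of the unit
-- ball at `x` has all seminorms at most `4 = 2 * 2` at nearby points of a normal chart, hence
-- weighted speed at most `4 * ∑ 2⁻ⁿ = 8`. A derivative below `-8 * ε` along it would give a
-- deformation.
theorem slopeFn_mem_Icc (hw' : ∀ n, w n ≤ (1 / 2) ^ n) {J : M → ℝ}
    (hJ : ∀ x, C1At (J ∘ (chartAt F x).symm) (chartAt F x x)) {x : M} {ε : ℝ}
    (hx : ¬ Deformable (S.weightedDist w) J x ε) : S.slopeFn J x ∈ Icc (-(ε * 8)) 0 := by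
  obtain ⟨a, s, W, hN⟩ := S.exists_isNormalChart x
  have hxa := hN.mem_source
  have hJa := (hJ x).of_chart hN.isC1Chart (isC1Chart_chartAt x) hxa (mem_chart_source F x)
  have hws : Summable w := Summable.of_nonneg_of_le (fun n => (hw n).le) hw' summable_geometric_two
  have hlow : ∀ v ∈ functionalDeriv J x '' S.unitBall x, -(ε * 8) ≤ v := by
    rintro _ ⟨h, hh, rfl⟩
    rw [functionalDeriv_eq hN.isC1Chart hxa hJa]
    by_contra! hlt
    refine hx (deformable_of_dirDeriv_lt (P := fun _ => 4) hw hN.isC1Chart hxa hJa ?_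
      (hws.mul_right 4) ?_ (by norm_num : (0 : ℝ) < 8) hlt)
    · filter_upwards [hN.mem_nhds] with u hu n
      have h1 := hN.snorm_le u hu n (coordOfTangent a x h)
      have h2 := hN.le_snorm _ (mem_of_mem_nhds hN.mem_nhds) n (coordOfTangent a x h)
      rw [← S.snorm_eq_coord hN.isC1Chart hxa] at h2
      have h3 := hh n
      linarith
    · rw [tsum_mul_right]
      have := hws.tsum_le_tsum hw' summable_geometric_two
      rw [tsum_geometric_two] at this
      linarith
  have h0 : (0 : ℝ) ∈ functionalDeriv J x '' S.unitBall x :=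
    ⟨0, fun n => by simp, (hJ x).dirDeriv_zero⟩
  exact ⟨le_csInf ⟨0, h0⟩ hlow, csInf_le ⟨_, hlow⟩ h0⟩

/-- Under the Palais–Smale condition, points of vanishing weak slope accumulate at a critical
point. -/
theorem exists_tendsto_isCriticalPt (hw : ∀ n, 0 < w n) (hw' : ∀ n, w n ≤ (1 / 2) ^ n)
    (hspan : ∀ p : M, ∃ x a s W, S.IsNormalChart x a s W ∧ p ∈ a.source ∧ W ∈ 𝓝 (a p) ∧
        ∀ l : F →L[ℝ] ℝ, (∀ h, Summable (fun n => w n * s n h) → l h = 0) → l = 0)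
    {J : M → ℝ} (hJ : ∀ x, C1At (J ∘ (chartAt F x).symm) (chartAt F x x)) {c : ℝ}
    (hPS : S.PalaisSmaleAt J c) {m : ℕ → M} {ε : ℕ → ℝ} (hε : Tendsto ε atTop (𝓝 0))
    (hm : Tendsto (fun i => J (m i)) atTop (𝓝 c))
    (hdef : ∀ i, ¬ Deformable (S.weightedDist w) J (m i) (ε i)) :
    ∃ (p : M) (k : ℕ → ℕ), StrictMono k ∧ Tendsto (m ∘ k) atTop (𝓝 p) ∧ J p = c ∧
      IsCriticalPt F J p := by
  have hslope : Tendsto (fun i => S.slopeFn J (m i)) atTop (𝓝 0) := by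
    refine tendsto_of_tendsto_of_tendsto_of_le_of_le (g := fun i => -(ε i * 8)) (h := fun _ => 0)
      ?_ tendsto_const_nhds (fun i => (slopeFn_mem_Icc hw hw' hJ (hdef i)).1)
      fun i => (slopeFn_mem_Icc hw hw' hJ (hdef i)).2
    simpa using (hε.mul_const 8).neg
  obtain ⟨p, k, hk, hp⟩ := hPS m hm hslope
  refine ⟨p, k, hk, hp, tendsto_nhds_unique
    (((continuous_of_c1At hJ).tendsto p).comp hp) (hm.comp hk.tendsto_atTop), ?_⟩
  obtain ⟨x, a, s, W, hN, hpa, hW, hl⟩ := hspan p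
  have hJa : ∀ q ∈ a.source, C1At (J ∘ a.symm) (a q) := fun q hq =>
    (hJ q).of_chart hN.isC1Chart (isC1Chart_chartAt q) hq (mem_chart_source F q)
  obtain ⟨l, hlD⟩ := (hJa p hpa).exists_continuousLinear
  have hap : Tendsto (fun i => a (m (k i))) atTop (𝓝 (a p)) := (a.continuousAt hpa).tendsto.comp hp
  -- If `l h < 0`, the derivative along `h` stays negative near `p` while `ε (k i) * K → 0`, so `m
  -- (k i)` would be deformable. Applying this to `h` and `-h` gives `l h = 0`.
  have hnonneg : ∀ h, Summable (fun n => w n * s n h) → 0 ≤ l h := by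
    intro h hsum
    by_contra! hneg
    set K := ∑' n, w n * (2 * s n h) + 1
    have hsum' : Summable fun n => w n * (2 * s n h) := by
      refine (hsum.mul_left 2).congr fun n => ?_
      ring
    have hK0 : 0 < K := by
      have : 0 ≤ ∑' n, w n * (2 * s n h) :=
        tsum_nonneg fun n => mul_nonneg (hw n).le (by positivity)
      simp only [K]
      linarith
    have h1 : Tendsto (fun i => dirDeriv (J ∘ a.symm) (a (m (k i))) h + ε (k i) * K) atTop
        (𝓝 (l h + 0 * K)) := by
      rw [← hlD]
      exact ((hJa p hpa).tendsto_dirDeriv hap tendsto_const_nhds).add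
        ((hε.comp hk.tendsto_atTop).mul_const K)
    rw [zero_mul, add_zero] at h1
    obtain ⟨i, hi1, hi2, hi3⟩ := ((h1.eventually (gt_mem_nhds hneg)).and
      ((hap.eventually (eventually_mem_nhds_iff.2 hW)).and
        (hp.eventually (a.open_source.mem_nhds hpa)))).exists
    have hlt : dirDeriv (J ∘ a.symm) (a (m (k i))) h < -(ε (k i) * K) := by linarith
    refine hdef (k i) (deformable_of_dirDeriv_lt (P := fun n => 2 * s n h) hw hN.isC1Chart hi3
      (hJa _ hi3) ?_ hsum' (show _ ≤ K by simp only [K]; linarith) hK0 hlt)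
    filter_upwards [hi2] with u hu n using hN.snorm_le u hu n h
  have hl0 := hl l fun h hsum => by
    have h1 := hnonneg h hsum
    have h2 := hnonneg (-h) (by simpa using hsum)
    rw [map_neg] at h2
    linarith
  intro h
  rw [functionalDeriv_eq hN.isC1Chart hpa (hJa p hpa), hlD, hl0]
  rfl

end GradedFinsler

end PalaisSmale


/-! ### Maps between manifolds and the critical points of `x ↦ I (φ x - q)`. -/

section GlobalDiffeo

set_option linter.unusedSectionVars false

variable {F E M N : Type*}
  [AddCommGroup F] [Module ℝ F] [UniformSpace F] [FrechetSpace F]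
  [AddCommGroup E] [Module ℝ E] [UniformSpace E] [FrechetSpace E]
  [TopologicalSpace M] [ChartedSpace F M] [TopologicalSpace N] [ChartedSpace E N]

/-! ### `C¹` maps between manifolds -/

variable (F E) in
/-- The map `f` between manifolds is of class `C¹` near `x`. -/
def MC1At (f : M → N) (x : M) : Prop :=
  ContinuousAt f x ∧ C1At (chartAt E (f x) ∘ f ∘ (chartAt F x).symm) (chartAt F x x)

theorem isOpen_representative_domain (e : OpenPartialHomeomorph M F)
    (e' : OpenPartialHomeomorph N E) {f : M → N} {s : Set M} (hf : ContinuousOn f s)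
    (hs : IsOpen s) : IsOpen (e.target ∩ e.symm ⁻¹' (s ∩ f ⁻¹' e'.source)) :=
  e.isOpen_inter_preimage_symm (hf.isOpen_inter_preimage hs e'.open_source)

theorem IsC1On.mc1At {f : M → N} {s : Set M} (hf : IsC1On F E f s) (hs : IsOpen s) {x : M}
    (hx : x ∈ s) : MC1At F E f x := by
  have hxc := mem_chart_source F x
  refine ⟨hf.1.continuousAt (hs.mem_nhds hx), ?_⟩
  refine (hf.2 _ (chart_mem_atlas F x) _ (chart_mem_atlas E (f x))).c1At
    (isOpen_representative_domain _ _ hf.1 hs) ⟨(chartAt F x).map_source hxc, ?_⟩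
  simpa [(chartAt F x).left_inv hxc] using hx

theorem MC1At.congr {f g : M → N} {x : M} (hf : MC1At F E f x) (hfg : f =ᶠ[𝓝 x] g) :
    MC1At F E g x := by
  refine ⟨hf.1.congr hfg, ?_⟩
  rw [← hfg.eq_of_nhds]
  refine hf.2.congr ?_
  filter_upwards [(symm_tendsto_nhds (mem_chart_source F x)).eventually hfg] with u hu
  simp [hu]

theorem comp_representative_eventuallyEq {f : M → N} {x : M} (hf : ContinuousAt f x) {Y : Type*}
    (g : N → Y) : (g ∘ (chartAt E (f x)).symm) ∘ (chartAt E (f x) ∘ f ∘ (chartAt F x).symm)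
      =ᶠ[𝓝 (chartAt F x x)] g ∘ f ∘ (chartAt F x).symm := by
  have h1 := (symm_tendsto_nhds (mem_chart_source F x)).eventually
    (hf.eventually ((chartAt E (f x)).open_source.mem_nhds (mem_chart_source E (f x))))
  filter_upwards [h1] with u hu
  simp [(chartAt E (f x)).left_inv hu]

theorem C1At.comp_manifold {G : Type*} [AddCommGroup G] [Module ℝ G] [UniformSpace G]
    [FrechetSpace G] {f : M → N} {x : M} {g : N → G}
    (hg : C1At (g ∘ (chartAt E (f x)).symm) (chartAt E (f x) (f x))) (hf : MC1At F E f x) :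
    C1At (g ∘ f ∘ (chartAt F x).symm) (chartAt F x x) := by
  refine (C1At.comp (f := chartAt E (f x) ∘ f ∘ (chartAt F x).symm) ?_ hf.2).congr
    (comp_representative_eventuallyEq hf.1 g)
  simpa [(chartAt F x).left_inv (mem_chart_source F x)] using hg

theorem MC1At.comp {H P : Type*} [AddCommGroup H] [Module ℝ H] [UniformSpace H] [FrechetSpace H]
    [TopologicalSpace P] [ChartedSpace H P] {f : M → N} {x : M} {g : N → P}
    (hg : MC1At E H g (f x)) (hf : MC1At F E f x) : MC1At F H (g ∘ f) x :=
  ⟨hg.1.comp hf.1, C1At.comp_manifold (g := chartAt H (g (f x)) ∘ g) hg.2 hf⟩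

theorem IsC1On.c1At_functional {J : M → ℝ} (hJ : IsC1On F ℝ J univ) (x : M) :
    C1At (J ∘ (chartAt F x).symm) (chartAt F x x) := by
  have := (hJ.mc1At isOpen_univ (mem_univ x)).2
  rw [chartAt_self_eq] at this
  exact this

theorem KellerC1On.mono {f : F → E} {U V : Set F} (hf : KellerC1On f U) (hVU : V ⊆ U) :
    KellerC1On f V := by
  obtain ⟨hc, f', hd, hf'⟩ := hf
  exact ⟨hc.mono hVU, f', fun x hx => hd x (hVU hx), hf'.mono hVU⟩

theorem IsC1On.univ_of_local {f : M → N}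
    (h : ∀ x, ∃ (s : Set M) (g : M → N), IsOpen s ∧ x ∈ s ∧ EqOn f g s ∧ IsC1On F E g s) :
    IsC1On F E f univ := by
  refine ⟨fun x _ => ?_, fun e he e' he' => KellerC1On.of_local fun u hu => ?_⟩
  · obtain ⟨s, g, hs, hx, hfg, hg⟩ := h x
    refine ((hg.1.congr hfg).continuousAt (hs.mem_nhds hx)).continuousWithinAt
  · obtain ⟨s, g, hs, hx, hfg, hg⟩ := h (e.symm u)
    refine ⟨e.target ∩ e.symm ⁻¹' s, e.isOpen_inter_preimage_symm hs, ⟨hu.1, hx⟩,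
      e' ∘ g ∘ e.symm, fun u' hu' => ?_, (hg.2 e he e' he').mono ?_⟩
    · simp only [Function.comp_apply]
      rw [hfg hu'.2]
    · rintro u' ⟨hu1, hu2⟩
      refine ⟨hu2.1, hu2.2, ?_⟩
      have h1 : f (e.symm u') ∈ e'.source := hu1.2.2
      rwa [hfg hu2.2] at h1

/-! ### The functionals `x ↦ I (ψ x)` -/

/-- If `ψ` has a `C¹` local right inverse `G` at `x`, critical points of `I ∘ ψ` are mapped to
critical points of `I`. -/
theorem IsCriticalPt.of_comp {ψ : M → N} {G : N → M} {x : M} {I : N → ℝ}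
    (hI : C1At (I ∘ (chartAt E (ψ x)).symm) (chartAt E (ψ x) (ψ x)))
    (hψ : MC1At F E ψ x) (hG : MC1At E F G (ψ x)) (hGx : G (ψ x) = x)
    (hψG : ∀ᶠ y in 𝓝 (ψ x), ψ (G y) = y) (hx : IsCriticalPt F (I ∘ ψ) x) :
    IsCriticalPt E I (ψ x) := by
  intro h
  have hJ : C1At ((I ∘ ψ) ∘ (chartAt F (G (ψ x))).symm) (chartAt F (G (ψ x)) (G (ψ x))) := by
    rw [hGx]
    exact hI.comp_manifold hψ
  set b := chartAt E (ψ x)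
  have h1 : ((I ∘ ψ) ∘ (chartAt F (G (ψ x))).symm) ∘ (chartAt F (G (ψ x)) ∘ G ∘ b.symm)
      =ᶠ[𝓝 (b (ψ x))] I ∘ b.symm := by
    refine (comp_representative_eventuallyEq hG.1 (I ∘ ψ)).trans ?_
    filter_upwards [(symm_tendsto_nhds (mem_chart_source E (ψ x))).eventually hψG] with u hu
    simp only [Function.comp_apply]
    rw [hu]
  have h2 : (chartAt F (G (ψ x)) ∘ G ∘ b.symm) (b (ψ x)) = chartAt F (G (ψ x)) (G (ψ x)) := by
    simp [b, b.left_inv (mem_chart_source E (ψ x))]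
  have h3 := C1At.dirDeriv_comp (f := chartAt F (G (ψ x)) ∘ G ∘ b.symm)
    (g := (I ∘ ψ) ∘ (chartAt F (G (ψ x))).symm) (x := b (ψ x)) (by rwa [h2]) hG.2 h
  rw [dirDeriv_congr h1, h2] at h3
  rw [functionalDeriv, h3, hGx]
  exact hx _

theorem IsC1LocalDiffeo.mc1At {φ : M → N} (hφ : IsC1LocalDiffeo F E φ) (x : M) :
    MC1At F E φ x := by
  obtain ⟨e, hx, heq, he, -⟩ := hφ x
  refine (he.mc1At e.open_source hx).congr ?_
  filter_upwards [e.open_source.mem_nhds hx] with y hy using (heq hy).symm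

theorem IsC1LocalDiffeo.isC1Diffeo_of_bijective {φ : M → N} (hφ : IsC1LocalDiffeo F E φ)
    (hb : Function.Bijective φ) : IsC1Diffeo F E φ := by
  refine ⟨IsC1On.univ_of_local fun x => ?_, (Equiv.ofBijective φ hb).symm,
    (Equiv.ofBijective φ hb).left_inv, (Equiv.ofBijective φ hb).right_inv,
    IsC1On.univ_of_local fun y => ?_⟩
  · obtain ⟨e, hx, heq, he, -⟩ := hφ x
    exact ⟨e.source, e, e.open_source, hx, heq, he⟩
  · obtain ⟨x, rfl⟩ := hb.2 y
    obtain ⟨e, hx, heq, -, he⟩ := hφ x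
    refine ⟨e.target, e.symm, e.open_target, ?_, fun z hz => ?_, he⟩
    · rw [heq hx]
      exact e.map_source hx
    · rw [Equiv.symm_apply_eq, Equiv.ofBijective_apply, heq (e.map_target hz), e.right_inv hz]

variable [AddGroup N]

theorem c1At_sub {φ : M → N} (hφ : IsC1LocalDiffeo F E φ)
    (hN : ∀ q : N, IsC1On E E (fun y : N => y - q) univ) {I : N → ℝ} (hI : IsC1On E ℝ I univ)
    (q : N) (x : M) :
    C1At ((fun x => I (φ x - q)) ∘ (chartAt F x).symm) (chartAt F x x) :=
  C1At.comp_manifold (f := fun x => φ x - q) (hI.c1At_functional _)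
    (MC1At.comp (g := fun y => y - q) ((hN q).mc1At isOpen_univ (mem_univ _)) (hφ.mc1At x))

theorem isCriticalPt_sub {φ : M → N} (hφ : IsC1LocalDiffeo F E φ)
    (hN : ∀ q : N, IsC1On E E (fun y : N => y - q) univ) {I : N → ℝ} (hI : IsC1On E ℝ I univ)
    (q : N) {x : M} (hx : IsCriticalPt F (fun x => I (φ x - q)) x) :
    IsCriticalPt E I (φ x - q) := by
  obtain ⟨e, hxe, heq, -, he⟩ := hφ x
  have h1 : φ x - q - -q = e x := by simp [heq hxe]
  have hsub : ∀ q y : N, MC1At E E (fun y : N => y - q) y := fun q y =>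
    (hN q).mc1At isOpen_univ (mem_univ y)
  have hmem : e x ∈ e.target := e.map_source hxe
  -- The local right inverse undoes the translation by `y - -q`, which has the form covered by the
  -- smoothness hypothesis `hN`.
  refine IsCriticalPt.of_comp (ψ := fun x => φ x - q) (G := fun y => e.symm (y - -q))
    (hI.c1At_functional _) (MC1At.comp (g := fun y => y - q) (hsub q _) (hφ.mc1At x))
    (MC1At.comp (g := e.symm) (f := fun y => y - -q) ?_ (hsub (-q) _)) ?_ ?_ hx
  · simp only [h1]
    exact he.mc1At e.open_target hmem
  · simp only [h1, e.left_inv hxe]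
  · have h2 : ∀ᶠ y in 𝓝 (φ x - q), y - -q ∈ e.target :=
      (hsub (-q) _).1.eventually (by simpa only [h1] using e.open_target.eventually_mem hmem)
    filter_upwards [h2] with y hy
    rw [heq (e.map_target hy), e.right_inv hy]
    simp

end GlobalDiffeo

/-! ### Existence of critical points by minimization and by mountain pass. -/

section MinMax

set_option linter.unusedSectionVars false

variable {F M : Type*}
  [AddCommGroup F] [Module ℝ F] [UniformSpace F] [FrechetSpace F]
  [TopologicalSpace M] [ChartedSpace F M] [FrechetC1Manifold F M] [ConnectedSpace M] [T2Space M]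
  [SecondCountableTopology M]

namespace GradedFinsler

variable {S : GradedFinsler F M} {J : M → ℝ}

/-- Minimizing sequences subconverge to critical points. -/
theorem exists_tendsto_of_minimizing (hS : S.IsCompleteMetric)
    (hJ : ∀ x, C1At (J ∘ (chartAt F x).symm) (chartAt F x x)) {c : ℝ} (hPS : S.PalaisSmaleAt J c)
    (hc : ∀ x, c ≤ J x) {y : ℕ → M} (hy : Tendsto (fun i => J (y i)) atTop (𝓝 c)) :
    ∃ (p : M) (k : ℕ → ℕ), StrictMono k ∧ Tendsto (y ∘ k) atTop (𝓝 p) ∧ J p = c ∧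
      IsCriticalPt F J p := by
  obtain ⟨w, hw, hw', hspan⟩ := S.exists_spanning_weights
  let := S.weightedMetric hw
  have := S.completeSpace_weightedMetric hw hS
  have hJc := continuous_of_c1At hJ
  -- The square root matches the excess `ε ^ 2` allowed in Ekeland's principle; the second summand
  -- keeps `ε i` positive when `J (y i) = c`.
  let ε : ℕ → ℝ := fun i => Real.sqrt (J (y i) - c) + 1 / ((i : ℝ) + 1)
  have hε : ∀ i, 0 < ε i := fun i => add_pos_of_nonneg_of_pos (Real.sqrt_nonneg _) (by positivity)
  have hε0 : Tendsto ε atTop (𝓝 0) := by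
    have h1 := ((hy.sub_const c).sqrt).add tendsto_one_div_add_atTop_nhds_zero_nat
    simpa [ε] using h1
  have hlt : ∀ i, J (y i) < c + ε i ^ 2 := fun i => by
    have h1 := Real.sq_sqrt (sub_nonneg.2 (hc (y i)))
    have h2 := Real.sqrt_nonneg (J (y i) - c)
    have h3 : 0 < 1 / ((i : ℝ) + 1) := by positivity
    simp only [ε]
    nlinarith
  choose x hxy hxJ hxd using fun i => exists_near_not_deformable hJc hc (hε i) (hlt i)
  have hxc : Tendsto (fun i => J (x i)) atTop (𝓝 c) :=
    tendsto_of_tendsto_of_tendsto_of_le_of_le tendsto_const_nhds hy (fun i => hc (x i)) hxJ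
  obtain ⟨p, k, hk, hp, hpc, hcrit⟩ := exists_tendsto_isCriticalPt hw hw' hspan hJ hPS
    (ε := fun i => 2 * ε i) (by simpa using hε0.const_mul 2) hxc hxd
  refine ⟨p, k, hk, ?_, hpc, hcrit⟩
  have hd : Tendsto (fun i => dist ((x ∘ k) i) ((y ∘ k) i)) atTop (𝓝 0) :=
    squeeze_zero (fun _ => dist_nonneg) (fun i => (hxy (k i)).le) (hε0.comp hk.tendsto_atTop)
  exact (tendsto_iff_of_dist hd).1 hp

/-- Mountain pass: a functional with a strict local minimum and another point at the same
level has a critical point at a higher level. -/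
theorem exists_isCriticalPt_of_two_zeros (hS : S.IsCompleteMetric)
    (hJ : ∀ x, C1At (J ∘ (chartAt F x).symm) (chartAt F x x)) (hPS : ∀ c, S.PalaisSmaleAt J c)
    (hJ0 : ∀ x, 0 ≤ J x) {x₁ x₂ : M} (hne : x₁ ≠ x₂) (h₁ : J x₁ = 0) (h₂ : J x₂ = 0)
    (hstrict : ∀ᶠ x in 𝓝 x₁, J x = 0 → x = x₁) : ∃ p, 0 < J p ∧ IsCriticalPt F J p := by
  obtain ⟨w, hw, hw', hspan⟩ := S.exists_spanning_weights
  let := S.weightedMetric hw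
  have := S.completeSpace_weightedMetric hw hS
  have hJc := continuous_of_c1At hJ
  obtain ⟨r₀, hr₀, hball⟩ := Metric.eventually_nhds_iff.1 hstrict
  obtain ⟨r, hr, hrr₀, hrd⟩ : ∃ r > 0, r < r₀ ∧ r < dist x₂ x₁ := by
    obtain ⟨r, hr, hr'⟩ := exists_between (lt_min hr₀ (dist_pos.2 hne.symm))
    exact ⟨r, hr, hr'.trans_le (min_le_left _ _), hr'.trans_le (min_le_right _ _)⟩
  -- Spheres need not be compact. Instead, points of the sphere with `J → 0` form a minimizing
  -- sequence, which subconverges to a zero of `J` on the sphere, where there is none.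
  obtain ⟨α, hα, hsphere⟩ : ∃ α > 0, ∀ y, dist y x₁ = r → α ≤ J y := by
    by_contra! hno
    choose y hyr hyJ using fun i : ℕ => hno (1 / ((i : ℝ) + 1)) (by positivity)
    obtain ⟨p, k, hk, hp, hp0, -⟩ := exists_tendsto_of_minimizing hS hJ (hPS 0) hJ0 (y := y)
      (squeeze_zero (fun i => hJ0 _) (fun i => (hyJ i).le) tendsto_one_div_add_atTop_nhds_zero_nat)
    have h3 : dist p x₁ = r := tendsto_nhds_unique (hp.dist tendsto_const_nhds)
      (by simp [hyr])
    have h4 := hball (h3.trans_lt hrr₀) hp0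
    rw [h4, dist_self] at h3
    exact hr.ne h3
  have := ChartedSpace.locallyPathConnectedSpace F M
  have := PathConnectedSpace.of_locallyPathConnectedSpace (X := M)
  have hj : Joined x₁ x₂ := PathConnectedSpace.joined x₁ x₂
  obtain ⟨c, hc, hlev⟩ := exists_mountain_pass_level hJc hj (h₁.trans_lt hα) (h₂.trans_lt hα)
    fun γ h0 h1 => by
      have hcont : Continuous fun t => dist (γ t) x₁ := by fun_prop
      obtain ⟨t, ht⟩ := mem_range_of_exists_le_of_exists_ge (c := r) hcont
        ⟨0, by simp [h0, hr.le]⟩ ⟨1, by simp [h1, hrd.le]⟩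
      exact ⟨t, hsphere _ ht⟩
  choose x hxc hxd using fun i : ℕ => hlev (1 / ((i : ℝ) + 1)) (by positivity)
  have hxJ : Tendsto (fun i => J (x i)) atTop (𝓝 c) := by
    rw [tendsto_iff_dist_tendsto_zero]
    exact squeeze_zero (fun _ => dist_nonneg) (fun i => (hxc i).le)
      tendsto_one_div_add_atTop_nhds_zero_nat
  obtain ⟨p, -, -, -, hpc, hcrit⟩ := exists_tendsto_isCriticalPt hw hw' hspan hJ (hPS c)
    tendsto_one_div_add_atTop_nhds_zero_nat hxJ hxd
  exact ⟨p, hpc ▸ hα.trans_le hc, hcrit⟩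

end GradedFinsler

end MinMax

end

/-! ### The global diffeomorphism theorem. -/

theorem theorem3p8
    {F E M N : Type*}
    [AddCommGroup F] [Module ℝ F] [UniformSpace F] [FrechetSpace F]
    [AddCommGroup E] [Module ℝ E] [UniformSpace E] [FrechetSpace E]
    [TopologicalSpace M] [T2Space M] [SecondCountableTopology M]
    [ChartedSpace F M] [FrechetC1Manifold F M] [ConnectedSpace M]
    [TopologicalSpace N] [T2Space N] [SecondCountableTopology N]
    [ChartedSpace E N] [FrechetC1Manifold E N] [ConnectedSpace N]
    (δ : GradedFinsler F M) (hδ : δ.IsCompleteMetric)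
    (ρ : GradedFinsler E N) (hρ : ρ.IsCompleteMetric)
    [AddGroup N] (hN : ∀ q : N, IsC1On E E (fun y : N => y - q) univ)
    (φ : M → N) (hφ : IsC1LocalDiffeo F E φ)
    (I : N → ℝ) (hI_nonneg : ∀ y, 0 ≤ I y) (hI : IsC1On E ℝ I univ)
    (hI_zero : ∀ y, I y = 0 ↔ y = 0)
    (hI_crit : ∀ y, IsCriticalPt E I y ↔ y = 0)
    (hPS : ∀ q : N, ∀ c : ℝ, δ.PalaisSmaleAt (fun x => I (φ x - q)) c) :
    IsC1Diffeo F E φ := by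
  have hJ := fun q => c1At_sub hφ hN hI q
  have hcrit : ∀ q x, IsCriticalPt F (fun x => I (φ x - q)) x → φ x = q := fun q x hx =>
    sub_eq_zero.1 ((hI_crit _).1 (isCriticalPt_sub hφ hN hI q hx))
  have hzero : ∀ q x, I (φ x - q) = 0 ↔ φ x = q := fun q x => by rw [hI_zero, sub_eq_zero]
  refine hφ.isC1Diffeo_of_bijective ⟨fun x₁ x₂ hx => ?_, fun q => ?_⟩
  -- Injectivity: the mountain pass point is critical, hence lies over `φ x₁`, where the functional
  -- is zero.
  · by_contra hne
    obtain ⟨e, hx₁, heq, -⟩ := hφ x₁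
    obtain ⟨p, hp, hpc⟩ := δ.exists_isCriticalPt_of_two_zeros hδ (hJ (φ x₁)) (hPS (φ x₁))
      (fun x => hI_nonneg _) hne ((hzero _ _).2 rfl) ((hzero _ _).2 hx.symm) (by
        filter_upwards [e.open_source.mem_nhds hx₁] with x hxe hx0
        rw [hzero, heq hxe, heq hx₁] at hx0
        exact e.injOn hxe hx₁ hx0)
    exact hp.ne' ((hzero _ _).2 (hcrit _ _ hpc))
  -- Surjectivity: the infimum is not known in advance to be `0`, so the Palais–Smale condition is
  -- invoked at the level of the infimum itself.
  · have hbdd : BddBelow (range fun x => I (φ x - q)) :=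
      ⟨0, by rintro _ ⟨x, rfl⟩; exact hI_nonneg _⟩
    obtain ⟨u, -, hu, hur⟩ := exists_seq_tendsto_sInf (range_nonempty fun x => I (φ x - q)) hbdd
    choose y hy using hur
    obtain ⟨p, -, -, -, -, hpc⟩ := GradedFinsler.exists_tendsto_of_minimizing hδ (hJ q) (hPS q _)
      (fun x => csInf_le hbdd (mem_range_self x)) (y := y) (by simpa only [hy] using hu)
    exact ⟨p, hcrit _ _ hpc⟩
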